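/- Let $\mathfrak h$ be a finite-dimensional complex Hilbert space, let $s_1,\dots,s_v\in\mathbb R^d$, and let $L_1,\dots,L_v\in B(\mathfrak h)$ satisfy $\sum_i L_i^*L_i=1$. Let $\mathfrak L(\sigma)=\sum_i L_i\sigma L_i^*$ be the associated quantum channel on $B(\mathfrak h)$ and $\mathfrak L^*(x)=\sum_i L_i^*xL_i$ its dual. For a positive operator $\omega$ put $\mathrm{supp}(\omega)=\ker(\omega)^\perp$. A subspace $\mathcal V\subset\mathfrak h$ is an *enclosure* if, for every positive $\omega$, $\mathrm{supp}(\omega)\subset\mathcal V$ implies $\mathrm{supp}(\mathfrak L(\omega))\subset\mathcal V$. An enclosure is *minimal* if it is nonzero and the only enclosures it contains are $\{0\}$ and itself. A *block* $\chi$ is a minimal element of the set of nonzero enclosures $\mathcal Y$ with the property that every minimal enclosure $\mathcal W$ satisfies $\mathcal W\perp\mathcal Y$ or $\mathcal W\subset\mathcal Y$. For a minimal enclosure $\mathcal V$ with orthogonal projection $p_{\mathcal V}$, let $A(\mathcal V)=\lim_{n\to\infty}\mathfrak L^{*n}(p_{\mathcal V})$, let $\tilde p_{\mathcal V}$ be the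 orthogonal projection onto $\mathrm{supp}(A(\mathcal V))$, and for $u\in\mathbb R^d$ let $\lambda_u^{\mathcal V}$ be the spectral radius of $$\tilde{\mathfrak L}_u(\sigma)=\sum_{i=1}^v e^{u\cdot s_i}\,\tilde p_{\mathcal V}L_i\tilde p_{\mathcal V}\,\sigma\,\tilde p_{\mathcal V}L_i^*\tilde p_{\mathcal V}.$$ Let $\tau_0^{\mathcal V}$ be the unique invariant state of $\mathfrak L$ (positive, trace one, $\mathfrak L(\tau)=\tau$) with support $\mathcal V$. Define $$m(\mathcal V)=\sum_{i=1}^v \mathrm{Tr}(L_i\tau_0^{\mathcal V}L_i^*)\,s_i,$$ and let $D(\mathcal V)$ be the unique real symmetric $d\times d$ matrix with $$\langle u,D(\mathcal V)u\rangle=\lambda_u''-(\lambda_u')^2\quad\text{for all }u\in\mathbb R^d,\qquad \lambda_u'=\tfrac{d}{dt}\lambda_{tu}^{\mathcal V}\big|_{t=0},\quad \lambda_u''=\tfrac{d^2}{dt^2}\lambda_{tu}^{\mathcal V}\big|_{t=0}.$$ **Lemma 4.1.** Let $\chi$ be a block. Then $\chi$ contains a minimal enclosure, for every minimal enclosure $\mathcal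 V\subset\chi$ the quantities $m(\mathcal V)$ and $D(\mathcal V)$ are well defined (in particular $\tau_0^{\mathcal V}$ exists and is unique, and $u\mapsto\lambda_u^{\mathcal V}$ is twice continuously differentiable near $0$), and $m(\mathcal V)$ and $D(\mathcal V)$ are the same for all minimal enclosures $\mathcal V\subset\chi$. Moreover, $D(\mathcal V)$ does not change if $\lambda_u^{\mathcal V}$ is replaced in its definition by the spectral radius of the deformation $\sigma\mapsto p_{\mathcal V}\big(\sum_i e^{u\cdot s_i}L_i\sigma L_i^*\big)p_{\mathcal V}$ of the channel restricted to $B(\mathcal V)\simeq p_{\mathcal V}B(\mathfrak h)p_{\mathcal V}$ (which is likewise twice continuously differentiable near $0$). Hence $m_\chi:=m(\mathcal V)$ and $D_\chi:=D(\mathcal V)$ are well defined. -/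

import Mathlib

open scoped InnerProductSpace

noncomputable section

namespace OQW

/-- The completely positive map `σ ↦ ∑ i, K i * σ * (K i)†` with Kraus operators `K i`. On a
finite-dimensional space every operator is trace class, so `L¹(E) = B(E)`. -/
def krausMap {E : Type*} [NormedAddCommGroup E] [InnerProductSpace ℂ E] [CompleteSpace E]
    {v : ℕ} (K : Fin v → E →L[ℂ] E) : Module.End ℂ (E →L[ℂ] E) where
  toFun σ := ∑ i, K i * σ * ContinuousLinearMap.adjoint (K i)
  map_add' σ τ := by simp [mul_add, add_mul, Finset.sum_add_distrib]
  map_smul' c σ := by simp [Finset.smul_sum]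

/-- The dual (Heisenberg) map `x ↦ ∑ i, (K i)† * x * K i` of `krausMap K`, characterized by
`Tr (ω Φ*(x)) = Tr (Φ(ω) x)`. -/
def dualKrausMap {E : Type*} [NormedAddCommGroup E] [InnerProductSpace ℂ E] [CompleteSpace E]
    {v : ℕ} (K : Fin v → E →L[ℂ] E) : Module.End ℂ (E →L[ℂ] E) :=
  krausMap fun i => ContinuousLinearMap.adjoint (K i)

/-- The trace of an operator on a finite-dimensional space. -/
def tr {E : Type*} [NormedAddCommGroup E] [InnerProductSpace ℂ E] (x : E →L[ℂ] E) : ℂ :=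
  LinearMap.trace ℂ E (x : E →ₗ[ℂ] E)

section

variable {H : Type*} [NormedAddCommGroup H] [InnerProductSpace ℂ H]

/-- The support of a positive operator, `supp x = (ker x)ᗮ`. -/
def supp (x : H →L[ℂ] H) : Submodule ℂ H :=
  (LinearMap.ker (x : H →ₗ[ℂ] H))ᗮ

/-- `V` is an enclosure (invariant domain) for `Φ`. -/
def IsEnclosure (Φ : Module.End ℂ (H →L[ℂ] H)) (V : Submodule ℂ H) : Prop :=
  ∀ ω : H →L[ℂ] H, ω.IsPositive → supp ω ≤ V → supp (Φ ω) ≤ V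

/-- A minimal enclosure: a nonzero enclosure whose only sub-enclosures are `0` and itself. -/
def IsMinimalEnclosure (Φ : Module.End ℂ (H →L[ℂ] H)) (V : Submodule ℂ H) : Prop :=
  IsEnclosure Φ V ∧ V ≠ ⊥ ∧ ∀ W, IsEnclosure Φ W → W ≤ V → W = ⊥ ∨ W = V

/-- Every minimal enclosure is either orthogonal to `X` or contained in `X`. -/
def Separates (Φ : Module.End ℂ (H →L[ℂ] H)) (X : Submodule ℂ H) : Prop :=
  ∀ W, IsMinimalEnclosure Φ W → W ⟂ X ∨ W ≤ X

/-- The blocks `χ_α` of the decomposition of the fast recurrent space: `X` is minimal among the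
nonzero enclosures that satisfy `Separates`. -/
def IsBlock (Φ : Module.End ℂ (H →L[ℂ] H)) (X : Submodule ℂ H) : Prop :=
  (IsEnclosure Φ X ∧ X ≠ ⊥ ∧ Separates Φ X) ∧
    ∀ Y, IsEnclosure Φ Y → Y ≠ ⊥ → Separates Φ Y → Y ≤ X → Y = X

/-- `τ` is an invariant state of `Φ` with support `V`. -/
def IsInvariantStateOn (Φ : Module.End ℂ (H →L[ℂ] H)) (V : Submodule ℂ H) (τ : H →L[ℂ] H) :
    Prop :=
  τ.IsPositive ∧ tr τ = 1 ∧ Φ τ = τ ∧ supp τ = V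

end

/-- The deformed Kraus operators `exp (u · s i / 2) K i`. -/
def deform {E : Type*} [NormedAddCommGroup E] [InnerProductSpace ℂ E] {d v : ℕ}
    (s : Fin v → EuclideanSpace ℝ (Fin d)) (u : EuclideanSpace ℝ (Fin d))
    (K : Fin v → E →L[ℂ] E) : Fin v → E →L[ℂ] E :=
  fun i => ((Real.exp (⟪u, s i⟫_ℝ / 2) : ℝ) : ℂ) • K i

/-- The spectral radius of the deformed map `σ ↦ ∑ i, exp (u · s i) K i σ (K i)†`,
as a function of `u`. -/
def radius {E : Type*} [NormedAddCommGroup E] [InnerProductSpace ℂ E] [CompleteSpace E]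
    {d v : ℕ} (s : Fin v → EuclideanSpace ℝ (Fin d)) (K : Fin v → E →L[ℂ] E)
    (u : EuclideanSpace ℝ (Fin d)) : ℝ :=
  (spectralRadius ℂ (krausMap (deform s u K))).toReal

section

variable {H : Type*} [NormedAddCommGroup H] [InnerProductSpace ℂ H] [CompleteSpace H]
  [FiniteDimensional ℂ H] {d v : ℕ}

/-- The absorption operator `A(V) = lim Φ*ⁿ(p_V)`, where `p_V` is the orthogonal projection
onto `V`. For an enclosure `V` the sequence is increasing and bounded by `1`, so it converges. -/
def absorption (L : Fin v → H →L[ℂ] H) (V : Submodule ℂ H) : H →L[ℂ] H :=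
  Filter.limUnder Filter.atTop fun n : ℕ => (dualKrausMap L ^ n) V.starProjection

/-- The operators `p L i p`, where `p` is the support projection of the absorption operator
of `V`. -/
def tildeKraus (L : Fin v → H →L[ℂ] H) (V : Submodule ℂ H) : Fin v → H →L[ℂ] H :=
  fun i => (supp (absorption L V)).starProjection * L i * (supp (absorption L V)).starProjection

/-- The Kraus operators, on the Hilbert space `V`, of the channel restricted to `V`, namely the
compressions of the `L i` to `V`. -/
def restrictKraus (L : Fin v → H →L[ℂ] H) (V : Submodule ℂ H) : Fin v → V →L[ℂ] V :=
  fun i => V.orthogonalProjectionOnto ∘L L i ∘L V.subtypeL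

/-- `u ↦ λ_u`, the spectral radius of the deformation of the channel compressed to the support
of the absorption operator of `V`. -/
def tildeRadius (s : Fin v → EuclideanSpace ℝ (Fin d)) (L : Fin v → H →L[ℂ] H)
    (V : Submodule ℂ H) (u : EuclideanSpace ℝ (Fin d)) : ℝ :=
  radius s (tildeKraus L V) u

/-- The spectral radius of the deformation of the channel restricted to `V`. -/
def restrictRadius (s : Fin v → EuclideanSpace ℝ (Fin d)) (L : Fin v → H →L[ℂ] H)
    (V : Submodule ℂ H) (u : EuclideanSpace ℝ (Fin d)) : ℝ :=
  haveI : CompleteSpace V := FiniteDimensional.complete ℂ V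
  radius s (restrictKraus L V) u

/-- `m = ∑ i, Tr (L i τ₀ (L i)†) s i`, where `τ₀` is the unique invariant state with support `V`;
existence and uniqueness of `τ₀` are part of the assertion. The traces are real numbers since
`τ₀` is positive. -/
def IsMean (s : Fin v → EuclideanSpace ℝ (Fin d)) (L : Fin v → H →L[ℂ] H) (V : Submodule ℂ H)
    (m : EuclideanSpace ℝ (Fin d)) : Prop :=
  (∃! τ, IsInvariantStateOn (krausMap L) V τ) ∧
    ∀ τ, IsInvariantStateOn (krausMap L) V τ →
      m = ∑ i, (tr (L i * τ * ContinuousLinearMap.adjoint (L i))).re • s i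

end

/-- `D` is the symmetric matrix with `⟨u, D u⟩ = r''_u - (r'_u)²` for all `u`, where `r'_u` and
`r''_u` are the first and second derivatives of `t ↦ r (t u)` at `t = 0`; that `r` is twice
continuously differentiable near `0` is part of the assertion. -/
def IsCovariance {d : ℕ} (r : EuclideanSpace ℝ (Fin d) → ℝ) (D : Matrix (Fin d) (Fin d) ℝ) :
    Prop :=
  ContDiffAt ℝ 2 r 0 ∧ D.IsSymm ∧
    ∀ u : EuclideanSpace ℝ (Fin d),
      u.ofLp ⬝ᵥ D.mulVec u.ofLp =
        iteratedDeriv 2 (fun t : ℝ => r (t • u)) 0 - deriv (fun t : ℝ => r (t • u)) 0 ^ 2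

end OQW

end

open scoped InnerProductSpace

noncomputable section

namespace OQW

set_option linter.unusedSectionVars false

open ContinuousLinearMap (adjoint)
open Filter Topology

/-! ### Kraus maps, their duals, and positive operators -/

section Kraus

variable {E : Type*} [NormedAddCommGroup E] [InnerProductSpace ℂ E] [CompleteSpace E] {v : ℕ}

/-! Write `Φ` for the channel, `Φ*` for its dual, `p` for the projection onto a minimal enclosure
`V`, and `A` for its absorption operator. Enclosures are the subspaces invariant under every `L i`
(`isEnclosure_iff`), so the channel restricted to `V` is irreducible. Averaging an orbit gives an
invariant state, and irreducibility makes it faithful and unique.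

Independence of `V`. For another minimal enclosure `W`, the operator `Φ*(p_W) - p_W` is positive and
has expectation zero in every invariant state. Testing it on a positive fixed point whose support
contains `V` shows that `p_W` restricted to `V` intertwines the two restricted channels
(`projection_intertwines`). By Schur's lemma it is zero or a multiple of a unitary, so
non-orthogonal minimal enclosures carry equivalent channels. The span of all enclosures in the block
equivalent to `V` is separating, hence is the block, and no minimal enclosure in the block can be
orthogonal to it (`restrictEquiv_of_le_block`). Unitary equivalence preserves the mean and the
restricted radius.

Smoothness and the two radii. A positive definite eigenvector of the dual map identifies its
eigenvalue as the spectral radius (`spectralRadius_krausMap_eq`). On `supp A`, the operator `A` is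
such an eigenvector at `u = 0`, with eigenvalue `1`. The implicit function theorem continues it to a
`C²` branch (`exists_posDef_branch`). Nondegeneracy is a maximum principle together with the fact
that every nonzero invariant subspace of the compressed maps contains `V`
(`IsMinimalEnclosure.le_map_of_invariant`). The branch stays positive definite near `0`, and
compressing it to the invariant space `V` keeps its eigenvalue, so both radii agree near `0`
(`exists_radius_branch`). -/

lemma krausMap_apply (K : Fin v → E →L[ℂ] E) (σ : E →L[ℂ] E) :
    krausMap K σ = ∑ i, K i * σ * adjoint (K i) := rfl

lemma dualKrausMap_apply (K : Fin v → E →L[ℂ] E) (x : E →L[ℂ] E) :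
    dualKrausMap K x = ∑ i, adjoint (K i) * x * K i := by
  simp [dualKrausMap, krausMap_apply]

lemma inner_krausMap (K : Fin v → E →L[ℂ] E) (σ : E →L[ℂ] E) (a b : E) :
    ⟪a, krausMap K σ b⟫_ℂ = ∑ i, ⟪adjoint (K i) a, σ (adjoint (K i) b)⟫_ℂ := by
  simp [krausMap_apply, ContinuousLinearMap.adjoint_inner_left]

lemma inner_dualKrausMap (K : Fin v → E →L[ℂ] E) (x : E →L[ℂ] E) (a b : E) :
    ⟪a, dualKrausMap K x b⟫_ℂ = ∑ i, ⟪K i a, x (K i b)⟫_ℂ := by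
  simp [dualKrausMap, inner_krausMap]

lemma krausMap_isPositive (K : Fin v → E →L[ℂ] E) {σ : E →L[ℂ] E} (hσ : σ.IsPositive) :
    (krausMap K σ).IsPositive := by
  rw [krausMap_apply]
  exact ContinuousLinearMap.isPositive_sum _ fun i _ => hσ.conj_adjoint (K i)

lemma dualKrausMap_isPositive (K : Fin v → E →L[ℂ] E) {x : E →L[ℂ] E} (hx : x.IsPositive) :
    (dualKrausMap K x).IsPositive :=
  krausMap_isPositive _ hx

lemma krausMap_isSelfAdjoint (K : Fin v → E →L[ℂ] E) {σ : E →L[ℂ] E} (hσ : IsSelfAdjoint σ) :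
    IsSelfAdjoint (krausMap K σ) := by
  rw [krausMap_apply]
  exact isSelfAdjoint_sum _ fun i _ => hσ.conjugate (K i)

lemma dualKrausMap_isSelfAdjoint (K : Fin v → E →L[ℂ] E) {x : E →L[ℂ] E}
    (hx : IsSelfAdjoint x) : IsSelfAdjoint (dualKrausMap K x) :=
  krausMap_isSelfAdjoint _ hx

/-- Writing `T = S† S` turns the quadratic form into `‖S y‖ ^ 2`. -/
lemma apply_eq_zero_of_isPositive {T : E →L[ℂ] E} (hT : T.IsPositive) {y : E}
    (hy : (⟪y, T y⟫_ℂ).re = 0) : T y = 0 := by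
  obtain ⟨S, rfl⟩ := CStarAlgebra.nonneg_iff_eq_star_mul_self.1
    ((ContinuousLinearMap.nonneg_iff_isPositive T).2 hT)
  have h : ‖S y‖ ^ 2 = 0 := by
    rw [← hy, ContinuousLinearMap.star_eq_adjoint, mul_apply_eq_comp,
      ContinuousLinearMap.adjoint_inner_right, inner_self_eq_norm_sq_to_K]
    norm_cast
  have h' : S y = 0 := by simpa using h
  simp [h']

lemma inner_self_re_nonneg_of_isPositive {T : E →L[ℂ] E} (hT : T.IsPositive) (y : E) :
    0 ≤ (⟪y, T y⟫_ℂ).re := hT.re_inner_nonneg_right y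

lemma isPositive_of_forall_re {T : E →L[ℂ] E} (hT : IsSelfAdjoint T)
    (h : ∀ y, 0 ≤ (⟪y, T y⟫_ℂ).re) : T.IsPositive := by
  rw [ContinuousLinearMap.isPositive_def']
  refine ⟨hT, fun y => ?_⟩
  rw [ContinuousLinearMap.reApplyInnerSelf_apply, inner_re_symm]
  exact h y

/-- A selfadjoint operator whose quadratic form vanishes is zero. -/
lemma eq_zero_of_forall_re {T : E →L[ℂ] E} (hT : IsSelfAdjoint T)
    (h : ∀ y, (⟪y, T y⟫_ℂ).re = 0) : T = 0 := by
  have hp := isPositive_of_forall_re hT fun y => (h y).ge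
  ext y
  simpa using apply_eq_zero_of_isPositive hp (h y)

lemma smul_re_inner (M : ℝ) (T : E →L[ℂ] E) (a b : E) :
    (⟪a, ((M : ℂ) • T) b⟫_ℂ).re = M * (⟪a, T b⟫_ℂ).re := by
  simp

end Kraus

/-! ### Trace duality and eigenvalues -/

section Trace

variable {E : Type*} [NormedAddCommGroup E] [InnerProductSpace ℂ E] [CompleteSpace E]
  [FiniteDimensional ℂ E] {v : ℕ}

lemma tr_add (x y : E →L[ℂ] E) : tr (x + y) = tr x + tr y := by simp [tr]

lemma tr_sub (x y : E →L[ℂ] E) : tr (x - y) = tr x - tr y := by simp [tr]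

lemma tr_smul (c : ℂ) (x : E →L[ℂ] E) : tr (c • x) = c * tr x := by simp [tr]

lemma tr_sum {ι : Type*} (s : Finset ι) (x : ι → E →L[ℂ] E) :
    tr (∑ i ∈ s, x i) = ∑ i ∈ s, tr (x i) := by
  simp [tr]

lemma tr_comp_comm {F : Type*} [NormedAddCommGroup F] [InnerProductSpace ℂ F]
    [FiniteDimensional ℂ F] (a : E →L[ℂ] F) (b : F →L[ℂ] E) :
    tr (a ∘L b) = tr (b ∘L a) := by
  simp only [tr]
  exact LinearMap.trace_comp_comm' _ _

lemma tr_mul_comm (a b : E →L[ℂ] E) : tr (a * b) = tr (b * a) := tr_comp_comm a b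

lemma tr_krausMap_mul (K : Fin v → E →L[ℂ] E) (σ x : E →L[ℂ] E) :
    tr (krausMap K σ * x) = tr (σ * dualKrausMap K x) := by
  rw [krausMap_apply, dualKrausMap_apply, Finset.sum_mul, Finset.mul_sum, tr_sum, tr_sum]
  refine Finset.sum_congr rfl fun i _ => ?_
  rw [mul_assoc, mul_assoc, tr_mul_comm, mul_assoc]

lemma tr_eq_sum (x : E →L[ℂ] E) {ι : Type*} [Fintype ι] (b : OrthonormalBasis ι ℂ E) :
    tr x = ∑ i, ⟪b i, x (b i)⟫_ℂ := by
  simp [tr, LinearMap.trace_eq_sum_inner _ b]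

lemma tr_re_nonneg {x : E →L[ℂ] E} (hx : x.IsPositive) : 0 ≤ (tr x).re := by
  rw [tr_eq_sum x (stdOrthonormalBasis ℂ E), Complex.re_sum]
  exact Finset.sum_nonneg fun i _ => inner_self_re_nonneg_of_isPositive hx _

/-- A positive operator is dominated by its trace. -/
lemma re_inner_le_tr {x : E →L[ℂ] E} (hx : x.IsPositive) (y : E) :
    (⟪y, x y⟫_ℂ).re ≤ (tr x).re * ‖y‖ ^ 2 := by
  by_cases hy : y = 0
  · simp [hy]
  have hn : ‖y‖ ≠ 0 := norm_ne_zero_iff.2 hy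
  set e : E := ((‖y‖⁻¹ : ℝ) : ℂ) • y with he
  have hye : y = ((‖y‖ : ℝ) : ℂ) • e := by
    rw [he, smul_smul, ← Complex.ofReal_mul, mul_inv_cancel₀ hn]; simp
  have hen : ‖e‖ = 1 := by
    rw [he, norm_smul, Complex.norm_real, norm_inv, norm_norm, inv_mul_cancel₀ hn]
  have ho : Orthonormal ℂ ((↑) : ({e} : Set E) → E) := by
    constructor
    · rintro ⟨z, rfl⟩; exact hen
    · rintro ⟨z, rfl⟩ ⟨w, rfl⟩ h; exact absurd rfl h
  -- In an orthonormal basis containing `e`, the trace is a sum of nonnegative terms, one of which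
  -- is the form at `e`.
  obtain ⟨u, b, hu, hb⟩ := ho.exists_orthonormalBasis_extension
  have h1 : (⟪e, x e⟫_ℂ).re ≤ (tr x).re := by
    rw [tr_eq_sum x b, Complex.re_sum]
    have := Finset.single_le_sum (f := fun i => (⟪b i, x (b i)⟫_ℂ).re)
      (fun i _ => inner_self_re_nonneg_of_isPositive hx _)
      (Finset.mem_univ (⟨e, hu rfl⟩ : u))
    simpa [hb] using this
  have h2 : (⟪y, x y⟫_ℂ).re = (⟪e, x e⟫_ℂ).re * ‖y‖ ^ 2 := by
    conv_lhs => rw [hye]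
    simp only [map_smul, inner_smul_left, inner_smul_right, Complex.conj_ofReal]
    rw [Complex.re_ofReal_mul, Complex.re_ofReal_mul]; ring
  rw [h2]
  gcongr

/-- Since the trace controls the norm on the positive cone, boundedness and convergence of operators
reduce to real sequences of traces. -/
lemma norm_le_tr {x : E →L[ℂ] E} (hx : x.IsPositive) : ‖x‖ ≤ (tr x).re := by
  have h0 := tr_re_nonneg hx
  rw [CStarAlgebra.norm_le_iff_le_algebraMap x h0
    ((ContinuousLinearMap.nonneg_iff_isPositive x).2 hx), ContinuousLinearMap.le_def]
  refine isPositive_of_forall_re ?_ fun y => ?_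
  · exact (IsSelfAdjoint.algebraMap _ (IsSelfAdjoint.all _)).sub hx.isSelfAdjoint
  · have := re_inner_le_tr hx y
    simp only [sub_apply, inner_sub_right, Complex.sub_re, sub_nonneg]
    rw [Algebra.algebraMap_eq_smul_one]
    simpa [inner_smul_right_eq_smul, inner_self_eq_norm_sq_to_K, ← Complex.ofReal_pow] using this

lemma eq_zero_of_tr_re_eq_zero {x : E →L[ℂ] E} (hx : x.IsPositive) (h : (tr x).re = 0) :
    x = 0 := by
  have := norm_le_tr hx
  rw [h] at this
  simpa using this

lemma tr_adjoint_mul_self_eq_zero {x : E →L[ℂ] E} (h : tr (x * adjoint x) = 0) : x = 0 := by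
  have h1 : x * adjoint x = 0 :=
    eq_zero_of_tr_re_eq_zero (ContinuousLinearMap.isPositive_self_comp_adjoint x) (by rw [h]; rfl)
  rw [← ContinuousLinearMap.star_eq_adjoint] at h1
  exact CStarRing.mul_star_self_eq_zero_iff x |>.1 h1

/-- The eigenvalues of a Kraus map are eigenvalues of its dual. -/
lemma hasEigenvalue_dualKrausMap {K : Fin v → E →L[ℂ] E} {μ : ℂ}
    (h : Module.End.HasEigenvalue (krausMap K) μ) :
    Module.End.HasEigenvalue (dualKrausMap K) μ := by
  obtain ⟨σ, hσ⟩ := h.exists_hasEigenvector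
  by_contra hne
  have hinj : Function.Injective (dualKrausMap K - algebraMap ℂ (Module.End ℂ (E →L[ℂ] E)) μ) := by
    rw [← LinearMap.ker_eq_bot]
    by_contra hk
    exact hne (Module.End.hasEigenvalue_iff.2 (by
      rwa [Module.End.eigenspace_def]))
  -- If `μ` is not an eigenvalue of the dual, `Φ* - μ` is onto. A preimage `b` of `σ†` gives `Tr (σ
  -- σ†) = Tr ((Φ σ - μ σ) b) = 0`.
  obtain ⟨b, hb⟩ := (LinearMap.injective_iff_surjective.1 hinj) (adjoint σ)
  apply hσ.2
  apply tr_adjoint_mul_self_eq_zero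
  rw [← hb]
  have h1 := tr_krausMap_mul K σ b
  rw [hσ.apply_eq_smul] at h1
  simp only [LinearMap.sub_apply, Module.algebraMap_end_apply, mul_sub, tr_sub, ← h1,
    smul_mul_assoc, mul_smul_comm, sub_self]

lemma spectralRadius_toReal_eq {M : Type*} [AddCommGroup M] [Module ℂ M] [FiniteDimensional ℂ M]
    {T : Module.End ℂ M} {r : ℝ} (hr : 0 ≤ r) (h : T.HasEigenvalue (r : ℂ))
    (h' : ∀ μ, T.HasEigenvalue μ → ‖μ‖ ≤ r) : (spectralRadius ℂ T).toReal = r := by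
  have : spectralRadius ℂ T = ENNReal.ofReal r := by
    apply le_antisymm
    · refine iSup₂_le fun μ hμ => ?_
      rw [← enorm_eq_nnnorm, ← ofReal_norm]
      exact ENNReal.ofReal_le_ofReal (h' μ (Module.End.hasEigenvalue_iff_mem_spectrum.2 hμ))
    · refine le_trans (le_of_eq ?_)
        (le_iSup₂ (f := fun (k : ℂ) (_ : k ∈ spectrum ℂ T) => (‖k‖₊ : ENNReal)) (r : ℂ)
          h.mem_spectrum)
      rw [← enorm_eq_nnnorm, ← ofReal_norm]
      simp [abs_of_nonneg hr]
  rw [this, ENNReal.toReal_ofReal hr]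

end Trace

/-! ### Spectral radius from a positive definite dual eigenvector -/

section SpectralRadius

variable {E : Type*} [NormedAddCommGroup E] [InnerProductSpace ℂ E] [CompleteSpace E]
  [FiniteDimensional ℂ E] {v : ℕ}

/-- The generalized Rayleigh quotient of `A` with respect to a positive definite form attains its
maximum. -/
lemma exists_rayleigh_max [Nontrivial E] (A : E →L[ℂ] E) {X : E →L[ℂ] E}
    (hX : ∀ y ≠ 0, 0 < (⟪y, X y⟫_ℂ).re) :
    ∃ (M : ℝ) (y : E), y ≠ 0 ∧ (⟪y, A y⟫_ℂ).re = M * (⟪y, X y⟫_ℂ).re ∧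
      ∀ z, (⟪z, A z⟫_ℂ).re ≤ M * (⟪z, X z⟫_ℂ).re := by
  have : ProperSpace E := FiniteDimensional.proper ℂ E
  have hne : ∀ y ∈ Metric.sphere (0 : E) 1, y ≠ 0 := by
    rintro y hy rfl
    simp at hy
  have hc : ContinuousOn (fun y : E => (⟪y, A y⟫_ℂ).re / (⟪y, X y⟫_ℂ).re)
      (Metric.sphere (0 : E) 1) := by
    refine ContinuousOn.div (by fun_prop) (by fun_prop) fun y hy => (hX y (hne y hy)).ne'
  obtain ⟨y, hy, hmax⟩ := (isCompact_sphere (0 : E) 1).exists_isMaxOn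
    (by
      obtain ⟨e, he⟩ := exists_ne (0 : E)
      refine ⟨((‖e‖⁻¹ : ℝ) : ℂ) • e, ?_⟩
      simp [norm_smul, he]) hc
  refine ⟨_, y, hne y hy, (div_mul_cancel₀ _ (hX y (hne y hy)).ne').symm, fun z => ?_⟩
  by_cases hz : z = 0
  · simp [hz]
  rw [← div_le_iff₀ (hX z hz)]
  have hzn : ‖z‖ ≠ 0 := norm_ne_zero_iff.2 hz
  have h := hmax (show ((‖z‖⁻¹ : ℝ) : ℂ) • z ∈ Metric.sphere (0 : E) 1 by
    simp [norm_smul, hz])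
  have hs : ∀ T : E →L[ℂ] E, (⟪((‖z‖⁻¹ : ℝ) : ℂ) • z, T (((‖z‖⁻¹ : ℝ) : ℂ) • z)⟫_ℂ).re
      = (‖z‖⁻¹ * ‖z‖⁻¹) * (⟪z, T z⟫_ℂ).re := by
    intro T
    simp only [map_smul, inner_smul_left, inner_smul_right, Complex.conj_ofReal]
    rw [Complex.re_ofReal_mul, Complex.re_ofReal_mul, mul_assoc]
  simp only [Set.mem_ofPred_eq, hs] at h
  rwa [mul_div_mul_left _ _ (by positivity)] at h

/-- Maximise `‖y‖ ^ 2` relative to the form of `X`; the inverse of the maximum is the constant. -/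
lemma exists_coercive {X : E →L[ℂ] E} (hX : ∀ y ≠ 0, 0 < (⟪y, X y⟫_ℂ).re) :
    ∃ c > 0, ∀ y, c * ‖y‖ ^ 2 ≤ (⟪y, X y⟫_ℂ).re := by
  rcases subsingleton_or_nontrivial E with h | h
  · exact ⟨1, one_pos, fun y => by simp [Subsingleton.elim y 0]⟩
  obtain ⟨M, y, hy, h1, h2⟩ := exists_rayleigh_max (1 : E →L[ℂ] E) hX
  have key : ∀ z : E, (⟪z, (1 : E →L[ℂ] E) z⟫_ℂ).re = ‖z‖ ^ 2 := by
    intro z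
    simp [inner_self_eq_norm_sq_to_K, ← Complex.ofReal_pow]
  simp only [key] at h1 h2
  have hM : 0 < M := by
    by_contra hM
    have := mul_nonpos_of_nonpos_of_nonneg (not_lt.1 hM) (hX y hy).le
    have : 0 < ‖y‖ ^ 2 := by positivity
    linarith
  refine ⟨M⁻¹, inv_pos.2 hM, fun z => ?_⟩
  rw [inv_mul_le_iff₀ hM]
  exact h2 z

lemma hasEigenvalue_krausMap_of_dual {K : Fin v → E →L[ℂ] E} {μ : ℂ}
    (h : Module.End.HasEigenvalue (dualKrausMap K) μ) :
    Module.End.HasEigenvalue (krausMap K) μ := by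
  have := hasEigenvalue_dualKrausMap (K := fun i => adjoint (K i)) h
  simpa [dualKrausMap] using this

variable {K : Fin v → E →L[ℂ] E} {X : E →L[ℂ] E} {r : ℝ}

lemma re_inner_dualKrausMap_eq (h : dualKrausMap K X = (r : ℂ) • X) (y : E) :
    ∑ i, (⟪K i y, X (K i y)⟫_ℂ).re = r * (⟪y, X y⟫_ℂ).re := by
  rw [← smul_re_inner, ← h, inner_dualKrausMap, Complex.re_sum]

lemma eigenvalue_nonneg [Nontrivial E] (hX : ∀ y ≠ 0, 0 < (⟪y, X y⟫_ℂ).re)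
    (h : dualKrausMap K X = (r : ℂ) • X) : 0 ≤ r := by
  have h0 : ∀ y, 0 ≤ (⟪y, X y⟫_ℂ).re := fun y => by
    by_cases hy : y = 0
    · simp [hy]
    · exact (hX y hy).le
  obtain ⟨e, he⟩ := exists_ne (0 : E)
  have h1 := re_inner_dualKrausMap_eq h e
  have h2 := Finset.sum_nonneg fun i (_ : i ∈ Finset.univ) => h0 (K i e)
  rw [h1] at h2
  exact nonneg_of_mul_nonneg_left h2 (hX e he)

/-- The form of a dual eigenvector `x` for `μ` is dominated by that of `X`. Under iteration the
first scales by `‖μ‖` and the second by `r`, so `r < ‖μ‖` would force `x = 0`. -/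
lemma norm_eigenvalue_le [Nontrivial E] (hX : ∀ y ≠ 0, 0 < (⟪y, X y⟫_ℂ).re)
    (h : dualKrausMap K X = (r : ℂ) • X) {μ : ℂ}
    (hμ : Module.End.HasEigenvalue (krausMap K) μ) : ‖μ‖ ≤ r := by
  have hr := eigenvalue_nonneg hX h
  by_contra! hlt
  have hμ0 : 0 < ‖μ‖ := hr.trans_lt hlt
  obtain ⟨x, hx⟩ := (hasEigenvalue_dualKrausMap hμ).exists_hasEigenvector
  obtain ⟨c, hc, hcX⟩ := exists_coercive hX
  -- The constant comes from Cauchy–Schwarz, the arithmetic–geometric mean inequality and coercivity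
  -- of `X`. A sum of forms in `a` and `b`, unlike a product, passes exactly through the sum over
  -- Kraus operators.
  have key : ∀ n : ℕ, ∀ a b, ‖⟪a, x b⟫_ℂ‖ ≤
      (r / ‖μ‖) ^ n * (‖x‖ / (2 * c) * ((⟪a, X a⟫_ℂ).re + (⟪b, X b⟫_ℂ).re)) := by
    intro n
    induction n with
    | zero =>
      intro a b
      have h1 : ‖⟪a, x b⟫_ℂ‖ ≤ ‖a‖ * (‖x‖ * ‖b‖) :=
        (norm_inner_le_norm _ _).trans (by gcongr; exact x.le_opNorm b)
      have h2 : ‖a‖ * ‖b‖ ≤ (‖a‖ ^ 2 + ‖b‖ ^ 2) / 2 := by nlinarith [sq_nonneg (‖a‖ - ‖b‖)]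
      calc ‖⟪a, x b⟫_ℂ‖ ≤ ‖x‖ * (‖a‖ * ‖b‖) := by linarith
        _ ≤ ‖x‖ * ((‖a‖ ^ 2 + ‖b‖ ^ 2) / 2) := by gcongr
        _ = ‖x‖ / (2 * c) * (c * ‖a‖ ^ 2 + c * ‖b‖ ^ 2) := by field_simp
        _ ≤ _ := by
          rw [pow_zero, one_mul]
          have := hcX a
          have := hcX b
          gcongr
    | succ n ih =>
      intro a b
      have h1 : ‖μ‖ * ‖⟪a, x b⟫_ℂ‖ ≤ ∑ i, ‖⟪K i a, x (K i b)⟫_ℂ‖ := by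
        rw [← norm_mul, ← inner_smul_right, ← smul_apply, ← hx.apply_eq_smul,
          inner_dualKrausMap]
        exact norm_sum_le _ _
      have h2 : ∑ i, ‖⟪K i a, x (K i b)⟫_ℂ‖ ≤
          (r / ‖μ‖) ^ n * (‖x‖ / (2 * c) * (r * (⟪a, X a⟫_ℂ).re + r * (⟪b, X b⟫_ℂ).re)) := by
        rw [← re_inner_dualKrausMap_eq h, ← re_inner_dualKrausMap_eq h, ← Finset.sum_add_distrib,
          Finset.mul_sum, Finset.mul_sum]
        exact Finset.sum_le_sum fun i _ => ih _ _
      rw [← mul_le_mul_iff_right₀ hμ0]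
      refine (h1.trans h2).trans (le_of_eq ?_)
      rw [pow_succ]
      field_simp
  apply hx.2
  ext b
  have h3 : ‖⟪x b, x b⟫_ℂ‖ ≤ 0 := by
    have hlim : Tendsto (fun n : ℕ => (r / ‖μ‖) ^ n *
        (‖x‖ / (2 * c) * ((⟪x b, X (x b)⟫_ℂ).re + (⟪b, X b⟫_ℂ).re))) atTop (𝓝 0) := by
      simpa using (tendsto_pow_atTop_nhds_zero_of_lt_one (div_nonneg hr hμ0.le)
        ((div_lt_one hμ0).2 hlt)).mul_const
          (‖x‖ / (2 * c) * ((⟪x b, X (x b)⟫_ℂ).re + (⟪b, X b⟫_ℂ).re))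
    exact ge_of_tendsto' hlim fun n => key n _ _
  simpa using h3

lemma hasEigenvalue_krausMap [Nontrivial E] (hX : ∀ y ≠ 0, 0 < (⟪y, X y⟫_ℂ).re)
    (h : dualKrausMap K X = (r : ℂ) • X) :
    Module.End.HasEigenvalue (krausMap K) (r : ℂ) := by
  refine hasEigenvalue_krausMap_of_dual (Module.End.hasEigenvalue_of_hasEigenvector (x := X)
    (Module.End.hasEigenvector_iff.2 ⟨Module.End.mem_eigenspace_iff.2 h, ?_⟩))
  rintro rfl
  obtain ⟨e, he⟩ := exists_ne (0 : E)
  simpa using hX e he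

/-- A Kraus map whose dual has a positive definite eigenvector has the corresponding eigenvalue as
its spectral radius. -/
lemma spectralRadius_krausMap_eq [Nontrivial E] (hX : ∀ y ≠ 0, 0 < (⟪y, X y⟫_ℂ).re)
    (h : dualKrausMap K X = (r : ℂ) • X) : (spectralRadius ℂ (krausMap K)).toReal = r :=
  spectralRadius_toReal_eq (eigenvalue_nonneg hX h) (hasEigenvalue_krausMap hX h)
    fun _ hμ => norm_eigenvalue_le hX h hμ

end SpectralRadius

/-! ### Maximum principle and uniqueness of dual fixed points -/

section Rigidity

variable {E : Type*} [NormedAddCommGroup E] [InnerProductSpace ℂ E] [CompleteSpace E]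
  [FiniteDimensional ℂ E] {v : ℕ} {K : Fin v → E →L[ℂ] E} {X : E →L[ℂ] E}

/-- Maximum principle: `x ≤ M X` implies `Φ*(x) ≤ M X`, and at a vector where the first inequality
is an equality the shift `c X` would overshoot if `c > 0`. -/
lemma shift_nonpos [Nontrivial E] (hX : ∀ y ≠ 0, 0 < (⟪y, X y⟫_ℂ).re)
    (h : dualKrausMap K X = X) {x : E →L[ℂ] E} {c : ℝ}
    (hx : dualKrausMap K x = x + (c : ℂ) • X) : c ≤ 0 := by
  obtain ⟨M, y, hy, h1, h2⟩ := exists_rayleigh_max x hX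
  have h3 : (⟪y, dualKrausMap K x y⟫_ℂ).re ≤ M * (⟪y, X y⟫_ℂ).re := by
    conv_rhs => rw [← h]
    rw [inner_dualKrausMap, inner_dualKrausMap, Complex.re_sum, Complex.re_sum, Finset.mul_sum]
    exact Finset.sum_le_sum fun i _ => h2 _
  rw [hx, add_apply, inner_add_right, Complex.add_re, smul_re_inner, h1] at h3
  have := hX y hy
  by_contra! hc
  nlinarith

/-- The null space of a positive fixed point of a dual Kraus map is invariant. -/
lemma apply_kraus_eq_zero {T : E →L[ℂ] E} (hT : T.IsPositive) (h : dualKrausMap K T = T) {y : E}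
    (hy : T y = 0) (i : Fin v) : T (K i y) = 0 := by
  have h1 : (⟪y, dualKrausMap K T y⟫_ℂ).re = 0 := by rw [h, hy]; simp
  rw [inner_dualKrausMap, Complex.re_sum,
    Finset.sum_eq_zero_iff_of_nonneg fun i _ => inner_self_re_nonneg_of_isPositive hT _] at h1
  exact apply_eq_zero_of_isPositive hT (h1 i (Finset.mem_univ i))

/-- For the least `M` with `x ≤ M X`, the difference `M X - x` is a positive fixed point with
nonzero kernel, and such a kernel is invariant. -/
lemma exists_invariant_extremal [Nontrivial E] (hXs : IsSelfAdjoint X)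
    (hX : ∀ y ≠ 0, 0 < (⟪y, X y⟫_ℂ).re) (h : dualKrausMap K X = X) {x : E →L[ℂ] E}
    (hxs : IsSelfAdjoint x) (hx : dualKrausMap K x = x) :
    ∃ (M : ℝ) (Y : Submodule ℂ E), Y ≠ ⊥ ∧ (∀ i, ∀ y ∈ Y, K i y ∈ Y) ∧
      (∀ y ∈ Y, x y = (M : ℂ) • X y) ∧ ∀ z, (⟪z, x z⟫_ℂ).re ≤ M * (⟪z, X z⟫_ℂ).re := by
  obtain ⟨M, y, hy, h1, h2⟩ := exists_rayleigh_max x hX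
  have hT : ((M : ℂ) • X - x).IsPositive := by
    refine isPositive_of_forall_re ?_ fun z => ?_
    · exact (IsSelfAdjoint.smul (by simp [IsSelfAdjoint]) hXs).sub hxs
    · rw [sub_apply, inner_sub_right, Complex.sub_re, smul_re_inner]
      exact sub_nonneg.2 (h2 z)
  refine ⟨M, LinearMap.ker (((M : ℂ) • X - x : E →L[ℂ] E) : E →ₗ[ℂ] E), ?_, ?_, ?_, h2⟩
  · refine (Submodule.ne_bot_iff _).2 ⟨y, ?_, hy⟩
    refine apply_eq_zero_of_isPositive hT ?_
    rw [sub_apply, inner_sub_right, Complex.sub_re, smul_re_inner, h1, sub_self]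
  · intro i z hz
    exact apply_kraus_eq_zero hT (by rw [map_sub, map_smul, h, hx]) hz i
  · intro z hz
    have : ((M : ℂ) • X - x) z = 0 := hz
    exact (sub_eq_zero.1 this).symm

/-- If any two nonzero invariant subspaces meet, the positive definite fixed point of the dual
Kraus map is unique up to scaling and is not a coboundary. -/
lemma eq_zero_of_dualKrausMap_eq_add [Nontrivial E] (hXs : IsSelfAdjoint X)
    (hX : ∀ y ≠ 0, 0 < (⟪y, X y⟫_ℂ).re) (h : dualKrausMap K X = X)
    (hmeet : ∀ Y Z : Submodule ℂ E, (∀ i, ∀ y ∈ Y, K i y ∈ Y) → (∀ i, ∀ y ∈ Z, K i y ∈ Z) →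
      Y ≠ ⊥ → Z ≠ ⊥ → Y ⊓ Z ≠ ⊥)
    {x : E →L[ℂ] E} (hxs : IsSelfAdjoint x) {c : ℝ}
    (hx : dualKrausMap K x = x + (c : ℂ) • X) (htr : (tr x).re = 0) : x = 0 ∧ c = 0 := by
  have hc : c = 0 := by
    refine le_antisymm (shift_nonpos hX h hx) ?_
    have := shift_nonpos hX h (x := -x) (c := -c) (by rw [map_neg, hx]; simp; abel)
    linarith
  refine ⟨?_, hc⟩
  rw [hc] at hx
  simp only [Complex.ofReal_zero, zero_smul, add_zero] at hx
  obtain ⟨M, Y, hY0, hYi, hYx, hM⟩ := exists_invariant_extremal hXs hX h hxs hx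
  obtain ⟨N, Z, hZ0, hZi, hZx, hN⟩ :=
    exists_invariant_extremal hXs hX h hxs.neg (by rw [map_neg, hx])
  -- At a common vector of the two extremal subspaces the best upper and lower bounds of `x` by
  -- multiples of `X` coincide. Hence `x = M X` everywhere, and the trace condition kills it.
  obtain ⟨y, hy, hy0⟩ := (Submodule.ne_bot_iff _).1 (hmeet Y Z hYi hZi hY0 hZ0)
  have hMN : M = -N := by
    have h1 := hYx y hy.1
    have h2 := hZx y hy.2
    have h3 : ((M + N : ℝ) : ℂ) • X y = 0 := by
      rw [Complex.ofReal_add, add_smul, ← h1, ← h2]; simp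
    have h4 : X y ≠ 0 := by
      intro h4
      have := hX y hy0
      rw [h4] at this
      simp at this
    rcases smul_eq_zero.1 h3 with h5 | h5
    · have : M + N = 0 := by exact_mod_cast h5
      linarith
    · exact absurd h5 h4
  have hxM : x - (M : ℂ) • X = 0 := by
    refine eq_zero_of_forall_re (hxs.sub (IsSelfAdjoint.smul (by simp [IsSelfAdjoint]) hXs))
      fun z => ?_
    rw [sub_apply, inner_sub_right, Complex.sub_re, smul_re_inner]
    have h1 := hM z
    have h2 := hN z
    rw [neg_apply, inner_neg_right, Complex.neg_re] at h2
    rw [hMN] at h1 ⊢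
    linarith
  rw [sub_eq_zero] at hxM
  have hXpos : X.IsPositive := isPositive_of_forall_re hXs fun y => by
    by_cases hy : y = 0
    · simp [hy]
    · exact (hX y hy).le
  rw [hxM, tr_smul, Complex.re_ofReal_mul, mul_eq_zero] at htr
  rcases htr with hM0 | hX0
  · rw [hxM, hM0]; simp
  · rw [hxM, eq_zero_of_tr_re_eq_zero hXpos hX0, smul_zero]

end Rigidity

/-! ### Continuation of a simple eigenvalue -/

section Branch

/-- A simple eigenvalue of a `C²` family of operators continues to a `C²` branch. -/
lemma exists_eigenvalue_branch {P S : Type*} [NormedAddCommGroup P] [NormedSpace ℝ P]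
    [CompleteSpace P] [NormedAddCommGroup S] [NormedSpace ℝ S] [FiniteDimensional ℝ S]
    (Ψ : P → S →L[ℝ] S) (hΨ : ContDiff ℝ 2 Ψ) (x₀ : S) (hx₀ : Ψ 0 x₀ = x₀) (φ : S →L[ℝ] ℝ)
    (hinj : ∀ (x : S) (c : ℝ), Ψ 0 x = x + c • x₀ → φ x = 0 → x = 0 ∧ c = 0) :
    ∃ (x : P → S) (r : P → ℝ), ContDiffAt ℝ 2 r 0 ∧ ContinuousAt x 0 ∧ x 0 = x₀ ∧
      ∀ᶠ u in 𝓝 0, Ψ u (x u) = r u • x u := by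
  have : CompleteSpace S := FiniteDimensional.complete ℝ S
  -- The unknowns are the eigenvector and the eigenvalue. The component `φ` fixes the scale of the
  -- eigenvector, so there are as many equations as unknowns.
  let f : P × (S × ℝ) → S × ℝ := fun q => (Ψ q.1 q.2.1 - q.2.2 • q.2.1, φ q.2.1)
  have hf : ContDiff ℝ 2 f := by
    refine ContDiff.prodMk (ContDiff.sub ?_ ?_) ?_
    · exact (hΨ.comp contDiff_fst).clm_apply (contDiff_fst.comp contDiff_snd)
    · exact (contDiff_snd.comp contDiff_snd).smul (contDiff_fst.comp contDiff_snd)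
    · exact φ.contDiff.comp (contDiff_fst.comp contDiff_snd)
  let q₀ : P × (S × ℝ) := (0, (x₀, 1))
  have hf₀ : ContDiffAt ℝ 2 f q₀ := hf.contDiffAt
  -- The partial derivative in the unknowns at `(x₀, 1)`. Its injectivity is precisely `hinj`, and
  -- finite dimension makes it invertible.
  let B : S × ℝ →L[ℝ] S × ℝ :=
    ((Ψ 0 ∘L ContinuousLinearMap.fst ℝ S ℝ) - (ContinuousLinearMap.fst ℝ S ℝ +
      (ContinuousLinearMap.snd ℝ S ℝ).smulRight x₀)).prod (φ ∘L ContinuousLinearMap.fst ℝ S ℝ)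
  have hB : fderiv ℝ f q₀ ∘L .inr ℝ P (S × ℝ) = B := by
    have h1 : HasFDerivAt (fun p : S × ℝ => f (0, p)) (fderiv ℝ f q₀ ∘L .inr ℝ P (S × ℝ))
        (x₀, (1 : ℝ)) :=
      (hf₀.differentiableAt two_ne_zero).hasFDerivAt.comp (x₀, (1 : ℝ))
        (hasFDerivAt_prodMk_right (0 : P) (x₀, (1 : ℝ)))
    have h2 : HasFDerivAt (fun p : S × ℝ => f (0, p)) B (x₀, (1 : ℝ)) := by
      have h3 : HasFDerivAt (fun p : S × ℝ => p.1) (ContinuousLinearMap.fst ℝ S ℝ)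
        (x₀, (1 : ℝ)) := hasFDerivAt_fst
      have h4 : HasFDerivAt (fun p : S × ℝ => p.2) (ContinuousLinearMap.snd ℝ S ℝ)
        (x₀, (1 : ℝ)) := hasFDerivAt_snd
      have h5 := h4.smul h3
      have h6 := (((Ψ 0).hasFDerivAt.comp (x₀, (1 : ℝ)) h3).sub h5).prodMk
        (φ.hasFDerivAt.comp (x₀, (1 : ℝ)) h3)
      simpa [B] using h6
    exact h1.unique h2
  have hBinj : Function.Injective B := by
    refine (injective_iff_map_eq_zero B).2 ?_
    rintro ⟨x, c⟩ hxc
    have h1 : Ψ 0 x - (x + c • x₀) = 0 := congrArg Prod.fst hxc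
    have h2 : φ x = 0 := congrArg Prod.snd hxc
    obtain ⟨rfl, rfl⟩ := hinj x c (sub_eq_zero.1 h1) h2
    rfl
  have hinv : (fderiv ℝ f q₀ ∘L .inr ℝ P (S × ℝ)).IsInvertible := by
    rw [hB]
    exact ⟨(LinearEquiv.ofInjectiveEndo (B : S × ℝ →ₗ[ℝ] S × ℝ)
      hBinj).toContinuousLinearEquiv, by ext <;> rfl⟩
  have hsm := hf₀.contDiffAt_implicitFunction two_ne_zero hinv
  refine ⟨fun u => (hf₀.implicitFunction two_ne_zero hinv u).1,
    fun u => (hf₀.implicitFunction two_ne_zero hinv u).2, contDiff_snd.contDiffAt.comp _ hsm,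
    (contDiff_fst.contDiffAt.comp _ hsm).continuousAt, ?_, ?_⟩
  · exact congrArg Prod.fst (hf₀.implicitFunction_apply_self two_ne_zero hinv)
  · filter_upwards [hf₀.eventually_apply_implicitFunction two_ne_zero hinv] with u hu
    have h1 := congrArg Prod.fst hu
    simpa [f, q₀, hx₀, sub_eq_zero] using h1

end Branch

/-! ### Positive definite eigenvectors of the deformed duals -/

section Deform

variable {E : Type*} [NormedAddCommGroup E] [InnerProductSpace ℂ E] [CompleteSpace E]
  {d v : ℕ} (s : Fin v → EuclideanSpace ℝ (Fin d))

lemma dualKrausMap_deform (K : Fin v → E →L[ℂ] E) (u : EuclideanSpace ℝ (Fin d))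
    (x : E →L[ℂ] E) : dualKrausMap (deform s u K) x =
      ∑ i, ((Real.exp ⟪u, s i⟫_ℝ : ℝ) : ℂ) • (adjoint (K i) * x * K i) := by
  rw [dualKrausMap_apply]
  refine Finset.sum_congr rfl fun i _ => ?_
  have : Real.exp ⟪u, s i⟫_ℝ = Real.exp (⟪u, s i⟫_ℝ / 2) * Real.exp (⟪u, s i⟫_ℝ / 2) := by
    rw [← Real.exp_add, add_halves]
  simp only [deform, map_smulₛₗ, Complex.conj_ofReal, smul_mul_assoc, mul_smul_comm, smul_smul,
    this, Complex.ofReal_mul]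

@[simp]
lemma deform_zero (K : Fin v → E →L[ℂ] E) : deform s 0 K = K := by
  ext; simp [deform]

variable [FiniteDimensional ℂ E]

lemma contDiff_sum_exp_smul {F : Type*} [NormedAddCommGroup F] [NormedSpace ℝ F] (B : Fin v → F) :
    ContDiff ℝ 2 fun u : EuclideanSpace ℝ (Fin d) => ∑ i, Real.exp ⟪u, s i⟫_ℝ • B i := by
  refine ContDiff.sum fun i _ => ?_
  have h : ContDiff ℝ 2 fun u : EuclideanSpace ℝ (Fin d) => Real.exp ⟪u, s i⟫_ℝ :=
    Real.contDiff_exp.comp (contDiff_id.inner ℝ contDiff_const)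
  exact h.smul contDiff_const

/-- The selfadjoint operators, as a real vector space. -/
abbrev Herm (E : Type*) [NormedAddCommGroup E] [InnerProductSpace ℂ E] [CompleteSpace E] :
    Submodule ℝ (E →L[ℂ] E) :=
  selfAdjoint.submodule ℝ (E →L[ℂ] E)

instance finiteDimensional_herm : FiniteDimensional ℝ (Herm E) := by
  have : FiniteDimensional ℝ (E →L[ℂ] E) := FiniteDimensional.complexToReal _
  infer_instance

/-- Conjugation `x ↦ k† x k` of selfadjoint operators. -/
def hermConj (k : E →L[ℂ] E) : Herm E →L[ℝ] Herm E :=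
  LinearMap.toContinuousLinearMap
    { toFun := fun x => ⟨adjoint k * x.1 * k, IsSelfAdjoint.conjugate' x.2 k⟩
      map_add' := fun x y => by ext; simp
      map_smul' := fun c x => by ext; simp }

lemma coe_hermConj (k : E →L[ℂ] E) (x : Herm E) :
    (hermConj k x : E →L[ℂ] E) = adjoint k * x.1 * k := rfl

/-- The deformed dual Kraus map on selfadjoint operators. -/
def hermDeform (K : Fin v → E →L[ℂ] E) (u : EuclideanSpace ℝ (Fin d)) : Herm E →L[ℝ] Herm E :=
  ∑ i, Real.exp ⟪u, s i⟫_ℝ • hermConj (K i)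

lemma coe_hermDeform (K : Fin v → E →L[ℂ] E) (u : EuclideanSpace ℝ (Fin d)) (x : Herm E) :
    (hermDeform s K u x : E →L[ℂ] E) = dualKrausMap (deform s u K) x := by
  rw [dualKrausMap_deform]
  simp only [hermDeform, sum_apply, smul_apply, Submodule.coe_sum, Submodule.coe_smul,
    coe_hermConj, Complex.coe_smul]

lemma contDiff_hermDeform (K : Fin v → E →L[ℂ] E) :
    ContDiff ℝ 2 (hermDeform s K : EuclideanSpace ℝ (Fin d) → Herm E →L[ℝ] Herm E) := by
  exact contDiff_sum_exp_smul s fun i => hermConj (K i)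

/-- The real trace of selfadjoint operators. -/
def hermTrace : Herm E →L[ℝ] ℝ :=
  LinearMap.toContinuousLinearMap
    { toFun := fun x => (tr x.1).re
      map_add' := fun x y => by simp [tr_add]
      map_smul' := fun c x => by
        have : ((c • x : Herm E) : E →L[ℂ] E) = (c : ℂ) • x.1 := (Complex.coe_smul c x.1).symm
        rw [this, tr_smul, Complex.re_ofReal_mul]; rfl }

/-- A perturbation of norm below the coercivity constant of `X` cannot destroy positivity. -/
lemma eventually_posDef {ι : Type*} {l : Filter ι} {x : ι → E →L[ℂ] E} {X : E →L[ℂ] E}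
    (hX : ∀ y ≠ 0, 0 < (⟪y, X y⟫_ℂ).re) (hx : Tendsto x l (𝓝 X)) :
    ∀ᶠ j in l, ∀ y ≠ 0, 0 < (⟪y, x j y⟫_ℂ).re := by
  obtain ⟨c, hc, hcX⟩ := exists_coercive hX
  filter_upwards [Metric.tendsto_nhds.1 hx c hc] with j hj y hy
  rw [dist_eq_norm] at hj
  have h1 : |(⟪y, (x j - X) y⟫_ℂ).re| ≤ ‖x j - X‖ * ‖y‖ ^ 2 := by
    refine (Complex.abs_re_le_norm _).trans ((norm_inner_le_norm _ _).trans ?_)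
    have := (x j - X).le_opNorm y
    nlinarith [norm_nonneg y]
  have h2 : ‖x j - X‖ * ‖y‖ ^ 2 < c * ‖y‖ ^ 2 := by gcongr
  rw [sub_apply, inner_sub_right, Complex.sub_re] at h1
  have h3 := hcX y
  have h4 := neg_abs_le ((⟪y, x j y⟫_ℂ).re - (⟪y, X y⟫_ℂ).re)
  linarith

/-- If any two nonzero invariant subspaces of a Kraus map meet, a positive definite fixed point of
its dual continues to positive definite eigenvectors of the deformed duals, with a `C²`
eigenvalue. -/
lemma exists_posDef_branch [Nontrivial E] {K : Fin v → E →L[ℂ] E} {X : E →L[ℂ] E}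
    (hXs : IsSelfAdjoint X) (hX : ∀ y ≠ 0, 0 < (⟪y, X y⟫_ℂ).re) (h : dualKrausMap K X = X)
    (hmeet : ∀ Y Z : Submodule ℂ E, (∀ i, ∀ y ∈ Y, K i y ∈ Y) → (∀ i, ∀ y ∈ Z, K i y ∈ Z) →
      Y ≠ ⊥ → Z ≠ ⊥ → Y ⊓ Z ≠ ⊥) :
    ∃ r : EuclideanSpace ℝ (Fin d) → ℝ, ContDiffAt ℝ 2 r 0 ∧
      ∀ᶠ u in 𝓝 0, ∃ x : E →L[ℂ] E, (∀ y ≠ 0, 0 < (⟪y, x y⟫_ℂ).re) ∧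
        dualKrausMap (deform s u K) x = (r u : ℂ) • x := by
  -- Working in the real space of selfadjoint operators, normalised by the trace, makes the
  -- continued eigenvalue real.
  obtain ⟨x, r, hr, hxc, hx0, hev⟩ := exists_eigenvalue_branch (hermDeform s K)
    (contDiff_hermDeform s K) (⟨X, hXs⟩ : Herm E)
    (Subtype.ext (by rw [coe_hermDeform, deform_zero, h])) hermTrace (by
      intro x c hx hφ
      have h1 : dualKrausMap K x.1 = x.1 + (c : ℂ) • X := by
        have := congrArg Subtype.val hx
        rw [coe_hermDeform, deform_zero] at this
        rw [this, Complex.coe_smul]; rfl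
      obtain ⟨h2, h3⟩ := eq_zero_of_dualKrausMap_eq_add hXs hX h hmeet x.2 h1 hφ
      exact ⟨Subtype.ext h2, h3⟩)
  refine ⟨r, hr, ?_⟩
  have hlim : Tendsto (fun u => (x u : E →L[ℂ] E)) (𝓝 0) (𝓝 X) := by
    have := (continuous_subtype_val.tendsto _).comp hxc
    rwa [hx0] at this
  filter_upwards [hev, eventually_posDef hX hlim] with u hu hpos
  refine ⟨x u, hpos, ?_⟩
  rw [← coe_hermDeform, hu, Complex.coe_smul]; rfl

end Deform

/-! ### Compression to a subspace and extension by zero -/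

section Compress

variable {H : Type*} [NormedAddCommGroup H] [InnerProductSpace ℂ H] [CompleteSpace H]
  [FiniteDimensional ℂ H] {d v : ℕ}

instance completeSpace_submodule (V : Submodule ℂ H) : CompleteSpace V :=
  FiniteDimensional.complete ℂ V

/-- The compression of an operator to a subspace. -/
def compress (W : Submodule ℂ H) (x : H →L[ℂ] H) : W →L[ℂ] W :=
  W.orthogonalProjectionOnto ∘L x ∘L W.subtypeL

/-- The extension by zero of an operator on a subspace. -/
def extend (W : Submodule ℂ H) (y : W →L[ℂ] W) : H →L[ℂ] H :=
  W.subtypeL ∘L y ∘L W.orthogonalProjectionOnto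

variable (W : Submodule ℂ H)

lemma coe_compress_apply (x : H →L[ℂ] H) (a : W) :
    (compress W x a : H) = W.starProjection (x a) := rfl

lemma extend_apply (y : W →L[ℂ] W) (a : H) :
    extend W y a = y (W.orthogonalProjectionOnto a) := rfl

lemma inner_compress (x : H →L[ℂ] H) (a b : W) :
    ⟪a, compress W x b⟫_ℂ = ⟪(a : H), x b⟫_ℂ := by
  rw [compress, ContinuousLinearMap.comp_apply,
    Submodule.inner_orthogonalProjectionOnto_eq_of_mem_left]
  rfl

lemma extend_apply_coe (y : W →L[ℂ] W) (a : W) : extend W y a = y a := by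
  rw [extend_apply, Submodule.orthogonalProjectionOnto_mem_subspace_eq_self]

lemma extend_apply_of_mem_orthogonal (y : W →L[ℂ] W) {z : H} (hz : z ∈ Wᗮ) :
    extend W y z = 0 := by
  rw [extend_apply, Submodule.orthogonalProjectionOnto_eq_zero_iff.2 hz]; simp

@[simp]
lemma compress_extend (y : W →L[ℂ] W) : compress W (extend W y) = y := by
  ext a
  rw [coe_compress_apply, extend_apply_coe, Submodule.starProjection_mem_subspace_eq_self]

lemma extend_injective : Function.Injective (extend W) :=
  Function.LeftInverse.injective (compress_extend W)

lemma adjoint_extend (y : W →L[ℂ] W) : adjoint (extend W y) = extend W (adjoint y) := by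
  rw [extend, ContinuousLinearMap.adjoint_comp, ContinuousLinearMap.adjoint_comp,
    Submodule.adjoint_subtypeL, Submodule.adjoint_orthogonalProjectionOnto]
  rfl

lemma compress_smul (c : ℂ) (x : H →L[ℂ] H) : compress W (c • x) = c • compress W x := by
  ext; simp [compress]

lemma extend_sum {ι : Type*} (t : Finset ι) (y : ι → W →L[ℂ] W) :
    extend W (∑ i ∈ t, y i) = ∑ i ∈ t, extend W (y i) := by
  ext; simp [extend, sum_apply]

lemma extend_smul (c : ℂ) (y : W →L[ℂ] W) : extend W (c • y) = c • extend W y := by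
  ext; simp [extend]

lemma extend_compress_eq (x : H →L[ℂ] H) :
    extend W (compress W x) = W.starProjection * x * W.starProjection := rfl

lemma isPositive_compress {x : H →L[ℂ] H} (hx : x.IsPositive) : (compress W x).IsPositive :=
  hx.orthogonalProjectionOnto_comp W

lemma isPositive_extend {y : W →L[ℂ] W} (hy : y.IsPositive) : (extend W y).IsPositive := by
  have := hy.conj_adjoint W.subtypeL
  rwa [Submodule.adjoint_subtypeL] at this

lemma tr_extend (y : W →L[ℂ] W) : tr (extend W y) = tr y := by
  rw [extend, tr_comp_comm, ContinuousLinearMap.comp_assoc]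
  congr 1
  ext a
  simp

lemma restrictKraus_eq (L : Fin v → H →L[ℂ] H) (i : Fin v) :
    restrictKraus L W i = compress W (L i) := rfl

lemma deform_restrictKraus (s : Fin v → EuclideanSpace ℝ (Fin d)) (u : EuclideanSpace ℝ (Fin d))
    (L : Fin v → H →L[ℂ] H) :
    deform s u (restrictKraus L W) = restrictKraus (deform s u L) W := by
  funext i
  simp only [deform, restrictKraus_eq, compress_smul]

lemma krausMap_extend_apply (K : Fin v → W →L[ℂ] W) (x : H →L[ℂ] H) :
    krausMap (fun i => extend W (K i)) x = extend W (krausMap K (compress W x)) := by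
  rw [krausMap_apply, krausMap_apply, extend_sum]
  refine Finset.sum_congr rfl fun i _ => ?_
  rw [adjoint_extend]
  rfl

lemma hasEigenvalue_krausMap_extend {K : Fin v → W →L[ℂ] W} {μ : ℂ}
    (h : Module.End.HasEigenvalue (krausMap K) μ) :
    Module.End.HasEigenvalue (krausMap fun i => extend W (K i)) μ := by
  obtain ⟨σ, hσ⟩ := h.exists_hasEigenvector
  refine Module.End.hasEigenvalue_of_hasEigenvector (x := extend W σ)
    (Module.End.hasEigenvector_iff.2 ⟨Module.End.mem_eigenspace_iff.2 ?_, fun h0 => hσ.2 ?_⟩)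
  · rw [krausMap_extend_apply, compress_extend, hσ.apply_eq_smul, extend_smul]
  · rw [← compress_extend W σ, h0]; simp [compress]

/-- An eigenvector for a nonzero eigenvalue lies in the range of `extend W`, so compressing it loses
nothing. -/
lemma hasEigenvalue_of_krausMap_extend {K : Fin v → W →L[ℂ] W} {μ : ℂ} (hμ : μ ≠ 0)
    (h : Module.End.HasEigenvalue (krausMap fun i => extend W (K i)) μ) :
    Module.End.HasEigenvalue (krausMap K) μ := by
  obtain ⟨x, hx⟩ := h.exists_hasEigenvector
  have h1 : extend W (krausMap K (compress W x)) = μ • x := by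
    rw [← krausMap_extend_apply, hx.apply_eq_smul]
  refine Module.End.hasEigenvalue_of_hasEigenvector (x := compress W x)
    (Module.End.hasEigenvector_iff.2 ⟨Module.End.mem_eigenspace_iff.2 ?_, fun h0 => hx.2 ?_⟩)
  · rw [← compress_smul, ← h1, compress_extend]
  · rw [h0, map_zero] at h1
    have : extend W 0 = 0 := by ext; simp [extend]
    rw [this] at h1
    exact (smul_eq_zero.1 h1.symm).resolve_left hμ

/-- Extending the Kraus operators by zero does not change the spectral radius. -/
lemma spectralRadius_krausMap_extend_eq [Nontrivial W] {K : Fin v → W →L[ℂ] W} {X : W →L[ℂ] W}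
    {r : ℝ} (hX : ∀ y ≠ 0, 0 < (⟪y, X y⟫_ℂ).re) (h : dualKrausMap K X = (r : ℂ) • X) :
    (spectralRadius ℂ (krausMap fun i => extend W (K i))).toReal = r := by
  refine spectralRadius_toReal_eq (eigenvalue_nonneg hX h)
    (hasEigenvalue_krausMap_extend W (hasEigenvalue_krausMap hX h)) fun μ hμ => ?_
  by_cases h0 : μ = 0
  · rw [h0, norm_zero]; exact eigenvalue_nonneg hX h
  · exact norm_eigenvalue_le hX h (hasEigenvalue_of_krausMap_extend W h0 hμ)

lemma op_ext_inner {F : Type*} [NormedAddCommGroup F] [InnerProductSpace ℂ F] {x y : F →L[ℂ] F}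
    (h : ∀ a b, ⟪a, x b⟫_ℂ = ⟪a, y b⟫_ℂ) : x = y := by
  ext b
  exact ext_inner_left ℂ fun a => h a b

/-- An operator vanishing on `Wᗮ` does not see the component of `L i a` outside `W`. This serves `W
= supp A`, which need not be invariant. -/
lemma dualKrausMap_restrictKraus_of_orthogonal (L : Fin v → H →L[ℂ] H) {x : H →L[ℂ] H}
    (hx : IsSelfAdjoint x) (h0 : ∀ z ∈ Wᗮ, x z = 0) :
    dualKrausMap (restrictKraus L W) (compress W x) = compress W (dualKrausMap L x) := by
  have h1 : ∀ a, x (W.starProjection a) = x a := fun a => by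
    have := h0 _ (W.sub_starProjection_mem_orthogonal a)
    rw [map_sub, sub_eq_zero] at this
    exact this.symm
  refine op_ext_inner fun a b => ?_
  rw [inner_compress, inner_dualKrausMap, inner_dualKrausMap]
  refine Finset.sum_congr rfl fun i _ => ?_
  rw [inner_compress, restrictKraus_eq, coe_compress_apply, coe_compress_apply, h1,
    ← ContinuousLinearMap.adjoint_inner_left, hx.adjoint_eq, h1, ← hx.adjoint_eq,
    ContinuousLinearMap.adjoint_inner_left, hx.adjoint_eq]

section Invariant

variable {W} {L : Fin v → H →L[ℂ] H} (hW : ∀ i, ∀ y ∈ W, L i y ∈ W)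
include hW

lemma coe_restrictKraus_apply (i : Fin v) (a : W) : (restrictKraus L W i a : H) = L i a := by
  rw [restrictKraus_eq, coe_compress_apply, Submodule.starProjection_eq_self_iff.2 (hW i a a.2)]

lemma dualKrausMap_restrictKraus_of_invariant (x : H →L[ℂ] H) :
    dualKrausMap (restrictKraus L W) (compress W x) = compress W (dualKrausMap L x) := by
  refine op_ext_inner fun a b => ?_
  rw [inner_compress, inner_dualKrausMap, inner_dualKrausMap]
  refine Finset.sum_congr rfl fun i _ => ?_
  rw [inner_compress, coe_restrictKraus_apply hW, coe_restrictKraus_apply hW]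

/-- Invariance says that the inclusion of `W` intertwines the Kraus operators; take adjoints for the
other side. The identity is kept for each `i` because the mean weights each Kraus operator
separately. -/
lemma kraus_mul_extend_mul_adjoint (i : Fin v) (σ : W →L[ℂ] W) :
    L i * extend W σ * adjoint (L i) =
      extend W (restrictKraus L W i * σ * adjoint (restrictKraus L W i)) := by
  have h1 : L i ∘L W.subtypeL = W.subtypeL ∘L restrictKraus L W i := by
    ext a
    exact (coe_restrictKraus_apply hW i a).symm
  have h2 : W.orthogonalProjectionOnto ∘L adjoint (L i) =
      adjoint (restrictKraus L W i) ∘L W.orthogonalProjectionOnto := by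
    have := congrArg adjoint h1
    rwa [ContinuousLinearMap.adjoint_comp, ContinuousLinearMap.adjoint_comp,
      Submodule.adjoint_subtypeL] at this
  calc L i * extend W σ * adjoint (L i)
      = (L i ∘L W.subtypeL) ∘L σ ∘L (W.orthogonalProjectionOnto ∘L adjoint (L i)) := rfl
    _ = _ := by rw [h1, h2]; rfl

lemma krausMap_extend (σ : W →L[ℂ] W) :
    krausMap L (extend W σ) = extend W (krausMap (restrictKraus L W) σ) := by
  rw [krausMap_apply, krausMap_apply, extend_sum]
  exact Finset.sum_congr rfl fun i _ => kraus_mul_extend_mul_adjoint hW i σ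

lemma dualKrausMap_restrictKraus_one (hL : ∑ i, adjoint (L i) * L i = 1) :
    dualKrausMap (restrictKraus L W) 1 = 1 := by
  have h1 : compress W (1 : H →L[ℂ] H) = 1 := by
    ext a
    rw [coe_compress_apply]
    simp
  have h2 : dualKrausMap L 1 = 1 := by
    rw [dualKrausMap_apply]; simpa using hL
  rw [← h1, dualKrausMap_restrictKraus_of_invariant hW, h2]

end Invariant

end Compress

/-! ### Enclosures as invariant subspaces -/

section Enclosure

variable {H : Type*} [NormedAddCommGroup H] [InnerProductSpace ℂ H] [CompleteSpace H]
  [FiniteDimensional ℂ H] {v : ℕ} {L : Fin v → H →L[ℂ] H}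

lemma orthogonal_supp (x : H →L[ℂ] H) : (supp x)ᗮ = LinearMap.ker (x : H →ₗ[ℂ] H) :=
  Submodule.orthogonal_orthogonal _

lemma mem_supp_orthogonal {x : H →L[ℂ] H} {z : H} : z ∈ (supp x)ᗮ ↔ x z = 0 := by
  rw [orthogonal_supp]; rfl

lemma supp_le_iff {x : H →L[ℂ] H} {V : Submodule ℂ H} : supp x ≤ V ↔ ∀ z ∈ Vᗮ, x z = 0 := by
  constructor
  · intro h z hz
    exact mem_supp_orthogonal.1 (Submodule.orthogonal_le h hz)
  · intro h
    rw [← Submodule.orthogonal_orthogonal V]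
    exact Submodule.orthogonal_le h

/-- Enclosures are the subspaces that are invariant under the Kraus operators. -/
lemma isEnclosure_iff {V : Submodule ℂ H} :
    IsEnclosure (krausMap L) V ↔ ∀ i, ∀ x ∈ V, L i x ∈ V := by
  constructor
  · intro h i x hx
    -- Rank-one test operators suffice: the image of `x x†` is the sum of the `(L i x)(L i x)†`, and
    -- a vanishing sum of nonnegative forms vanishes termwise.
    have h1 := supp_le_iff.1 (h (InnerProductSpace.rankOne ℂ x x)
      (InnerProductSpace.isPositive_rankOne_self x) (supp_le_iff.2 fun z hz => by
        rw [InnerProductSpace.rankOne_apply, hz x hx, zero_smul]))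
    rw [← Submodule.orthogonal_orthogonal V]
    refine fun z hz => ?_
    have h2 : (⟪z, krausMap L (InnerProductSpace.rankOne ℂ x x) z⟫_ℂ).re = 0 := by
      rw [h1 z hz]; simp
    rw [inner_krausMap, Complex.re_sum, Finset.sum_eq_zero_iff_of_nonneg fun i _ =>
      inner_self_re_nonneg_of_isPositive (InnerProductSpace.isPositive_rankOne_self x) _] at h2
    have h3 := apply_eq_zero_of_isPositive (InnerProductSpace.isPositive_rankOne_self x)
      (h2 i (Finset.mem_univ i))
    rw [InnerProductSpace.rankOne_apply, smul_eq_zero] at h3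
    rcases h3 with h3 | h3
    · rw [ContinuousLinearMap.adjoint_inner_right] at h3
      rw [← inner_conj_symm, h3, map_zero]
    · rw [h3]; simp
  · intro h ω _ hω
    rw [supp_le_iff] at hω ⊢
    intro z hz
    rw [krausMap_apply, sum_apply]
    refine Finset.sum_eq_zero fun i _ => ?_
    have : adjoint (L i) z ∈ Vᗮ := fun x hx => by
      rw [ContinuousLinearMap.adjoint_inner_right]
      exact hz _ (h i x hx)
    rw [mul_apply_eq_comp, mul_apply_eq_comp, hω _ this, map_zero]

/-- A nonzero invariant subspace contains a minimal enclosure. -/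
lemma exists_isMinimalEnclosure_le {X : Submodule ℂ H} (hX : IsEnclosure (krausMap L) X)
    (hX0 : X ≠ ⊥) : ∃ V, IsMinimalEnclosure (krausMap L) V ∧ V ≤ X := by
  obtain ⟨V, ⟨hV, hV0, hVX⟩, hmin⟩ := WellFounded.has_min (wellFounded_lt (α := Submodule ℂ H))
    {V | IsEnclosure (krausMap L) V ∧ V ≠ ⊥ ∧ V ≤ X} ⟨X, hX, hX0, le_rfl⟩
  refine ⟨V, ⟨hV, hV0, fun Y hY hYV => ?_⟩, hVX⟩
  by_cases hY0 : Y = ⊥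
  · exact Or.inl hY0
  · refine Or.inr (hYV.eq_of_not_lt fun hlt => hmin Y ⟨hY, hY0, hYV.trans hVX⟩ hlt)

end Enclosure

/-! ### The absorption operator and its support -/

section Absorption

variable {H : Type*} [NormedAddCommGroup H] [InnerProductSpace ℂ H] [CompleteSpace H]
  [FiniteDimensional ℂ H] {v : ℕ} {L : Fin v → H →L[ℂ] H} {V : Submodule ℂ H}

lemma dualKrausMap_mono {x y : H →L[ℂ] H} (h : x ≤ y) : dualKrausMap L x ≤ dualKrausMap L y := by
  rw [ContinuousLinearMap.le_def] at h ⊢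
  rw [← map_sub]
  exact dualKrausMap_isPositive L h

lemma re_inner_le_of_le {x y : H →L[ℂ] H} (h : x ≤ y) (a : H) :
    (⟪a, x a⟫_ℂ).re ≤ (⟪a, y a⟫_ℂ).re := by
  have := inner_self_re_nonneg_of_isPositive ((ContinuousLinearMap.le_def _ _).1 h) a
  rw [sub_apply, inner_sub_right, Complex.sub_re] at this
  linarith

lemma dualKrausMap_one (hL : ∑ i, adjoint (L i) * L i = 1) : dualKrausMap L 1 = 1 := by
  rw [dualKrausMap_apply]; simpa using hL

lemma dualKrausMap_apply_of_fixes (hL : ∑ i, adjoint (L i) * L i = 1)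
    (hV : ∀ i, ∀ y ∈ V, L i y ∈ V) {x : H →L[ℂ] H} (hx : ∀ y ∈ V, x y = y) :
    ∀ y ∈ V, dualKrausMap L x y = y := by
  intro y hy
  have h1 : y = (1 : H →L[ℂ] H) y := rfl
  conv_rhs => rw [h1, ← hL]
  rw [dualKrausMap_apply, sum_apply, sum_apply]
  refine Finset.sum_congr rfl fun i _ => ?_
  rw [mul_apply_eq_comp, mul_apply_eq_comp, mul_apply_eq_comp, hx _ (hV i y hy)]

/-- Invariance of `V` and `∑ (L i)† L i = 1` make `Φ*(p)` the identity on `V`. By selfadjointness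
only its corner on `Vᗮ` remains, an explicitly positive operator measuring the flow from `Vᗮ` into
`V`. -/
lemma dualKrausMap_starProjection_sub (hL : ∑ i, adjoint (L i) * L i = 1)
    (hV : ∀ i, ∀ y ∈ V, L i y ∈ V) :
    dualKrausMap L V.starProjection - V.starProjection =
      dualKrausMap (fun i => V.starProjection * L i * (1 - V.starProjection)) 1 := by
  set p := V.starProjection with hp
  have hps : adjoint p = p := isSelfAdjoint_starProjection V
  have hpp : p * p = p := V.isIdempotentElem_starProjection
  have h1 : dualKrausMap L p * p = p := by
    ext y
    exact dualKrausMap_apply_of_fixes hL hV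
      (fun y hy => Submodule.starProjection_eq_self_iff.2 hy) _ (V.starProjection_apply_mem y)
  have h2 : p * dualKrausMap L p = p := by
    have hs : star (dualKrausMap L p) = dualKrausMap L p :=
      dualKrausMap_isSelfAdjoint L (isSelfAdjoint_starProjection V)
    have := congrArg star h1
    rwa [star_mul, hs, ContinuousLinearMap.star_eq_adjoint, hps] at this
  have h3 : dualKrausMap (fun i => p * L i * (1 - p)) 1 =
      (1 - p) * dualKrausMap L p * (1 - p) := by
    rw [dualKrausMap_apply, dualKrausMap_apply, Finset.mul_sum, Finset.sum_mul]
    refine Finset.sum_congr rfl fun i _ => ?_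
    have h4 : adjoint (p * L i * (1 - p)) = (1 - p) * adjoint (L i) * p := by
      rw [← ContinuousLinearMap.star_eq_adjoint, star_mul, star_mul, star_sub, star_one,
        ContinuousLinearMap.star_eq_adjoint, ContinuousLinearMap.star_eq_adjoint, hps, mul_assoc]
    rw [h4, mul_one]
    calc (1 - p) * adjoint (L i) * p * (p * L i * (1 - p))
        = (1 - p) * adjoint (L i) * (p * p) * L i * (1 - p) := by noncomm_ring
      _ = _ := by rw [hpp]; noncomm_ring
  rw [h3]
  calc dualKrausMap L p - p = dualKrausMap L p - p - p + p := by abel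
    _ = dualKrausMap L p - dualKrausMap L p * p - p * dualKrausMap L p
        + p * (dualKrausMap L p * p) := by rw [h1, h2, hpp]
    _ = _ := by noncomm_ring

lemma starProjection_le_dualKrausMap (hL : ∑ i, adjoint (L i) * L i = 1)
    (hV : ∀ i, ∀ y ∈ V, L i y ∈ V) : V.starProjection ≤ dualKrausMap L V.starProjection := by
  rw [ContinuousLinearMap.le_def, dualKrausMap_starProjection_sub hL hV]
  exact dualKrausMap_isPositive _ ContinuousLinearMap.isPositive_one

lemma pow_dualKrausMap_succ (n : ℕ) (x : H →L[ℂ] H) :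
    (dualKrausMap L ^ (n + 1)) x = dualKrausMap L ((dualKrausMap L ^ n) x) := by
  rw [pow_succ']; rfl

lemma monotone_pow_starProjection (hL : ∑ i, adjoint (L i) * L i = 1)
    (hV : ∀ i, ∀ y ∈ V, L i y ∈ V) :
    Monotone fun n : ℕ => (dualKrausMap L ^ n) V.starProjection := by
  refine monotone_nat_of_le_succ fun n => ?_
  induction n with
  | zero => simpa using starProjection_le_dualKrausMap hL hV
  | succ n ih =>
    rw [pow_dualKrausMap_succ, pow_dualKrausMap_succ (n + 1)]
    exact dualKrausMap_mono ih

lemma starProjection_isPositive (V : Submodule ℂ H) : V.starProjection.IsPositive :=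
  ContinuousLinearMap.IsPositive.of_isStarProjection isStarProjection_starProjection

lemma isPositive_pow_starProjection (n : ℕ) :
    ((dualKrausMap L ^ n) V.starProjection).IsPositive := by
  induction n with
  | zero => simpa using starProjection_isPositive V
  | succ n ih => rw [pow_dualKrausMap_succ]; exact dualKrausMap_isPositive _ ih

lemma pow_starProjection_le_one (hL : ∑ i, adjoint (L i) * L i = 1) (n : ℕ) :
    (dualKrausMap L ^ n) V.starProjection ≤ 1 := by
  induction n with
  | zero =>
    have : (1 : H →L[ℂ] H) - V.starProjection = Vᗮ.starProjection :=
      V.starProjection_orthogonal'.symm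
    rw [ContinuousLinearMap.le_def, pow_zero, Module.End.one_apply, this]
    exact starProjection_isPositive _
  | succ n ih =>
    rw [pow_dualKrausMap_succ, ← dualKrausMap_one hL]
    exact dualKrausMap_mono ih

/-- A monotone bounded sequence of operators converges. -/
lemma exists_tendsto_of_monotone {x : ℕ → H →L[ℂ] H} (hx : Monotone x) {b : H →L[ℂ] H}
    (hb : ∀ n, x n ≤ b) : ∃ a, Tendsto x atTop (𝓝 a) := by
  -- For ordered operators the trace increment bounds the norm of the difference, so convergence of
  -- the bounded monotone traces gives a Cauchy sequence.
  have htr : ∀ {y z : H →L[ℂ] H}, y ≤ z → ‖z - y‖ ≤ (tr z).re - (tr y).re := fun h => by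
    have := norm_le_tr ((ContinuousLinearMap.le_def _ _).1 h)
    rwa [tr_sub, Complex.sub_re] at this
  have hmono : Monotone fun n => (tr (x n)).re := fun m n h => by
    have := (norm_nonneg _).trans (htr (hx h))
    simpa using this
  have hbdd : BddAbove (Set.range fun n => (tr (x n)).re) := ⟨(tr b).re, by
    rintro _ ⟨n, rfl⟩
    have := (norm_nonneg _).trans (htr (hb n))
    simpa using this⟩
  have hlim := tendsto_atTop_ciSup hmono hbdd
  set t := ⨆ n, (tr (x n)).re
  refine cauchySeq_tendsto_of_complete (cauchySeq_of_le_tendsto_0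
    (fun n => t - (tr (x n)).re) ?_ (by
      have := (tendsto_const_nhds (x := t)).sub hlim
      rwa [sub_self] at this))
  have key : ∀ n m N, N ≤ n → n ≤ m → dist (x n) (x m) ≤ t - (tr (x N)).re := by
    intro n m N hN hnm
    rw [dist_comm, dist_eq_norm]
    have h1 := htr (hx hnm)
    have h2 := hmono hN
    have h3 := le_ciSup hbdd m
    simp only at h2 h3
    linarith
  intro n m N hn hm
  rcases le_total n m with h | h
  · exact key n m N hn h
  · rw [dist_comm]; exact key m n N hm h

lemma tendsto_absorption (hL : ∑ i, adjoint (L i) * L i = 1) (hV : ∀ i, ∀ y ∈ V, L i y ∈ V) :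
    Tendsto (fun n : ℕ => (dualKrausMap L ^ n) V.starProjection) atTop (𝓝 (absorption L V)) :=
  tendsto_nhds_limUnder (exists_tendsto_of_monotone (monotone_pow_starProjection hL hV)
    (pow_starProjection_le_one hL))

lemma tendsto_re_inner {x : ℕ → H →L[ℂ] H} {a : H →L[ℂ] H} (h : Tendsto x atTop (𝓝 a)) (y : H) :
    Tendsto (fun n => (⟪y, x n y⟫_ℂ).re) atTop (𝓝 (⟪y, a y⟫_ℂ).re) := by
  have hc : Continuous fun T : H →L[ℂ] H => (⟪y, T y⟫_ℂ).re := by fun_prop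
  exact (hc.tendsto a).comp h

lemma isSelfAdjoint_of_tendsto {x : ℕ → H →L[ℂ] H} {a : H →L[ℂ] H}
    (h : Tendsto x atTop (𝓝 a)) (hx : ∀ n, IsSelfAdjoint (x n)) : IsSelfAdjoint a := by
  have h1 : Tendsto (fun n => star (x n)) atTop (𝓝 (star a)) := (continuous_star.tendsto a).comp h
  simp only [fun n => (hx n).star_eq] at h1
  exact tendsto_nhds_unique h1 h

lemma isPositive_of_tendsto {x : ℕ → H →L[ℂ] H} {a : H →L[ℂ] H}
    (h : Tendsto x atTop (𝓝 a)) (hx : ∀ n, (x n).IsPositive) : a.IsPositive :=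
  isPositive_of_forall_re (isSelfAdjoint_of_tendsto h fun n => (hx n).isSelfAdjoint) fun y =>
    ge_of_tendsto' (tendsto_re_inner h y) fun n => inner_self_re_nonneg_of_isPositive (hx n) y

lemma continuous_krausMap (K : Fin v → H →L[ℂ] H) : Continuous (krausMap K) := by
  have : ⇑(krausMap K) = fun σ => ∑ i, K i * σ * adjoint (K i) := rfl
  rw [this]
  fun_prop

lemma isPositive_absorption (hL : ∑ i, adjoint (L i) * L i = 1) (hV : ∀ i, ∀ y ∈ V, L i y ∈ V) :
    (absorption L V).IsPositive :=
  isPositive_of_tendsto (tendsto_absorption hL hV) isPositive_pow_starProjection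

lemma dualKrausMap_absorption (hL : ∑ i, adjoint (L i) * L i = 1)
    (hV : ∀ i, ∀ y ∈ V, L i y ∈ V) : dualKrausMap L (absorption L V) = absorption L V := by
  have h1 := ((continuous_krausMap fun i => adjoint (L i)).tendsto _).comp
    (tendsto_absorption hL hV)
  have h2 := (tendsto_add_atTop_iff_nat 1).2 (tendsto_absorption hL hV)
  refine tendsto_nhds_unique h1 (h2.congr fun n => ?_)
  rw [pow_dualKrausMap_succ]; rfl

lemma absorption_apply (hL : ∑ i, adjoint (L i) * L i = 1)
    (hV : ∀ i, ∀ y ∈ V, L i y ∈ V) {y : H} (hy : y ∈ V) : absorption L V y = y := by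
  have h1 : ∀ n : ℕ, ∀ y ∈ V, (dualKrausMap L ^ n) V.starProjection y = y := by
    intro n
    induction n with
    | zero => exact fun y hy => Submodule.starProjection_eq_self_iff.2 hy
    | succ n ih => rw [pow_dualKrausMap_succ]; exact dualKrausMap_apply_of_fixes hL hV ih
  have hc : Continuous fun T : H →L[ℂ] H => T y := by fun_prop
  have h2 := (hc.tendsto _).comp (tendsto_absorption hL hV)
  refine tendsto_nhds_unique h2 (tendsto_const_nhds.congr fun n => (h1 n y hy).symm)

lemma pow_starProjection_le_absorption (hL : ∑ i, adjoint (L i) * L i = 1)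
    (hV : ∀ i, ∀ y ∈ V, L i y ∈ V) (n : ℕ) (y : H) :
    (⟪y, (dualKrausMap L ^ n) V.starProjection y⟫_ℂ).re ≤ (⟪y, absorption L V y⟫_ℂ).re :=
  Monotone.ge_of_tendsto (f := fun n : ℕ => (⟪y, (dualKrausMap L ^ n) V.starProjection y⟫_ℂ).re)
    (fun _ _ h => re_inner_le_of_le (monotone_pow_starProjection hL hV h) y)
    (tendsto_re_inner (tendsto_absorption hL hV) y) n

lemma le_supp_absorption (hL : ∑ i, adjoint (L i) * L i = 1)
    (hV : ∀ i, ∀ y ∈ V, L i y ∈ V) : V ≤ supp (absorption L V) := by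
  intro y hy z hz
  have hz' : absorption L V z = 0 := hz
  rw [← absorption_apply hL hV hy, ← (isPositive_absorption hL hV).inner_left_eq_inner_right, hz',
    inner_zero_left]

lemma absorption_pos (hL : ∑ i, adjoint (L i) * L i = 1) (hV : ∀ i, ∀ y ∈ V, L i y ∈ V)
    {y : H} (hy : y ∈ supp (absorption L V)) (hy0 : y ≠ 0) :
    0 < (⟪y, absorption L V y⟫_ℂ).re := by
  refine lt_of_le_of_ne (inner_self_re_nonneg_of_isPositive (isPositive_absorption hL hV) y)
    fun h => hy0 ?_
  have h1 : y ∈ (supp (absorption L V))ᗮ :=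
    mem_supp_orthogonal.2 (apply_eq_zero_of_isPositive (isPositive_absorption hL hV) h.symm)
  exact inner_self_eq_zero.1 (h1 y hy)

lemma dualKrausMap_restrictKraus_absorption (hL : ∑ i, adjoint (L i) * L i = 1)
    (hV : ∀ i, ∀ y ∈ V, L i y ∈ V) :
    dualKrausMap (restrictKraus L (supp (absorption L V)))
      (compress (supp (absorption L V)) (absorption L V)) =
      compress (supp (absorption L V)) (absorption L V) := by
  rw [dualKrausMap_restrictKraus_of_orthogonal _ _ (isPositive_absorption hL hV).isSelfAdjoint
    fun z hz => mem_supp_orthogonal.1 hz, dualKrausMap_absorption hL hV]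

/-- On the support of the absorption operator, the mass outside `V` is detected strictly. -/
lemma starProjection_lt_absorption (hL : ∑ i, adjoint (L i) * L i = 1)
    (hV : ∀ i, ∀ y ∈ V, L i y ∈ V) {y : H} (hy : y ∈ supp (absorption L V)) (hyV : y ∉ V) :
    (⟪y, V.starProjection y⟫_ℂ).re < (⟪y, absorption L V y⟫_ℂ).re := by
  set A := absorption L V
  have hA := isPositive_absorption hL hV
  set a := V.starProjection y with ha
  set b := y - a with hb
  have haV : a ∈ V := V.starProjection_apply_mem y
  have hbV : b ∈ Vᗮ := V.sub_starProjection_mem_orthogonal y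
  have hb0 : b ≠ 0 := fun h => hyV (by rw [sub_eq_zero.1 h]; exact haV)
  have hbA : b ∈ supp A := Submodule.sub_mem _ hy (le_supp_absorption hL hV haV)
  have hyab : y = a + b := by rw [hb]; abel
  -- Since `A` is the identity on `V`, the cross terms vanish and the excess over the projection is
  -- the form of `A` at `b`.
  have h1 : ⟪y, A y⟫_ℂ = ⟪a, a⟫_ℂ + ⟪b, A b⟫_ℂ := by
    have h2 : ⟪a, A b⟫_ℂ = 0 := by
      rw [← hA.inner_left_eq_inner_right, absorption_apply hL hV haV]
      exact hbV a haV
    have h3 : ⟪b, A a⟫_ℂ = 0 := by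
      rw [absorption_apply hL hV haV, ← inner_conj_symm, hbV a haV, map_zero]
    have h4 : ⟪a, A a⟫_ℂ = ⟪a, a⟫_ℂ := by rw [absorption_apply hL hV haV]
    rw [hyab, map_add, inner_add_left, inner_add_right, inner_add_right, h2, h3, h4]
    ring
  have h5 : ⟪y, a⟫_ℂ = ⟪a, a⟫_ℂ := by
    conv_lhs => rw [hyab]
    rw [inner_add_left, ← inner_conj_symm b a, hbV a haV, map_zero, add_zero]
  rw [h1, h5, Complex.add_re]
  exact lt_add_of_pos_right _ (absorption_pos hL hV hbA hb0)

/-- Every nonzero invariant subspace of the compressed channel on the support of the absorption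
operator meets `V`. -/
lemma exists_mem_of_invariant (hL : ∑ i, adjoint (L i) * L i = 1) (hV : ∀ i, ∀ y ∈ V, L i y ∈ V)
    {W : Submodule ℂ H} (hW : W = supp (absorption L V)) {Y : Submodule ℂ W}
    (hY : ∀ i, ∀ y ∈ Y, restrictKraus L W i y ∈ Y) (hY0 : Y ≠ ⊥) :
    ∃ y ∈ Y, (y : H) ∈ V ∧ y ≠ 0 := by
  by_contra! hne
  set A := absorption L V with hAdef
  have hA := isPositive_absorption hL hV
  have : Nontrivial Y := Submodule.nontrivial_iff_ne_bot.2 hY0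
  have hpos : ∀ y : Y, y ≠ 0 → 0 < (⟪y, compress Y (compress W A) y⟫_ℂ).re := by
    intro y hy
    rw [inner_compress, inner_compress]
    exact absorption_pos hL hV (hW ▸ (y : W).2) (by simpa using hy)
  -- Let `M` be the largest ratio of the forms of `p` and `A` on `Y`. It is attained at a vector
  -- outside `V`, so `M < 1`.
  obtain ⟨M, y, hy0, hy, hM⟩ :=
    exists_rayleigh_max (E := Y) (compress Y (compress W V.starProjection))
      (X := compress Y (compress W A)) hpos
  simp only [inner_compress] at hy hM
  have hypos := hpos y hy0
  simp only [inner_compress] at hypos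
  have hM1 : M < 1 := by
    have h1 := starProjection_lt_absorption hL hV (hW ▸ (y : W).2)
      fun h => hy0 (Subtype.ext (hne y y.2 h))
    rw [hy] at h1
    by_contra! hM1
    nlinarith
  -- Invariance of `Y` carries the bound `p ≤ M A` on `Y` to every iterate `(Φ*)ⁿ(p)`. The limit
  -- would give `A ≤ M A` on `Y`, against `M < 1`.
  have key : ∀ n : ℕ, ∀ z ∈ Y, (⟪(z : H), (dualKrausMap L ^ n) V.starProjection z⟫_ℂ).re ≤
      M * (⟪(z : H), A z⟫_ℂ).re := by
    intro n
    induction n with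
    | zero => exact fun z hz => hM ⟨z, hz⟩
    | succ n ih =>
      intro z hz
      have hkill : ∀ {T : H →L[ℂ] H}, T.IsPositive → (∀ w ∈ Wᗮ, T w = 0) → ∀ i,
          (⟪L i z, T (L i z)⟫_ℂ).re =
            (⟪(restrictKraus L W i z : H), T (restrictKraus L W i z)⟫_ℂ).re := by
        intro T hT h0 i
        have h1 := h0 _ (W.sub_starProjection_mem_orthogonal (L i z))
        rw [map_sub, sub_eq_zero] at h1
        rw [restrictKraus_eq, coe_compress_apply, ← h1, ← hT.inner_left_eq_inner_right,
          ← hT.inner_left_eq_inner_right, h1]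
      have hA0 : ∀ w ∈ Wᗮ, A w = 0 := fun w hw => mem_supp_orthogonal.1 (hW ▸ hw)
      -- The iterates are positive and lie below `A`, so they vanish wherever `A` does.
      have hn0 : ∀ w ∈ Wᗮ, (dualKrausMap L ^ n) V.starProjection w = 0 := by
        intro w hw
        refine apply_eq_zero_of_isPositive (isPositive_pow_starProjection n) (le_antisymm ?_ ?_)
        · refine (pow_starProjection_le_absorption hL hV n w).trans ?_
          rw [hA0 w hw]; simp
        · exact inner_self_re_nonneg_of_isPositive (isPositive_pow_starProjection n) w
      have hAeq : A = dualKrausMap L A := (dualKrausMap_absorption hL hV).symm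
      conv_rhs => rw [hAeq]
      rw [pow_dualKrausMap_succ, inner_dualKrausMap, inner_dualKrausMap, Complex.re_sum,
        Complex.re_sum, Finset.mul_sum]
      refine Finset.sum_le_sum fun i _ => ?_
      rw [hkill (isPositive_pow_starProjection n) hn0, hkill hA hA0]
      exact ih _ (hY i z hz)
  have hlim := le_of_tendsto' (tendsto_re_inner (tendsto_absorption hL hV) (y : H))
    fun n => key n y y.2
  rw [← hAdef] at hlim
  nlinarith

end Absorption

/-! ### Comparison of the two spectral radii -/

section Radius

variable {H : Type*} [NormedAddCommGroup H] [InnerProductSpace ℂ H] [CompleteSpace H]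
  [FiniteDimensional ℂ H] {d v : ℕ} {L : Fin v → H →L[ℂ] H} {V : Submodule ℂ H}

lemma IsMinimalEnclosure.invariant (hV : IsMinimalEnclosure (krausMap L) V) :
    ∀ i, ∀ y ∈ V, L i y ∈ V :=
  isEnclosure_iff.1 hV.1

/-- Every nonzero invariant subspace of the compressed channel on the support of the absorption
operator of a minimal enclosure `V` contains `V`. -/
lemma IsMinimalEnclosure.le_map_of_invariant (hL : ∑ i, adjoint (L i) * L i = 1)
    (hV : IsMinimalEnclosure (krausMap L) V) {W : Submodule ℂ H} (hW : W = supp (absorption L V))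
    {Y : Submodule ℂ W} (hY : ∀ i, ∀ y ∈ Y, restrictKraus L W i y ∈ Y) (hY0 : Y ≠ ⊥) :
    V ≤ Y.map W.subtype := by
  obtain ⟨y, hyY, hyV, hy0⟩ := exists_mem_of_invariant hL hV.invariant hW hY hY0
  have hVW : V ≤ W := hW ▸ le_supp_absorption hL hV.invariant
  have h1 : IsEnclosure (krausMap L) (Y.map W.subtype ⊓ V) := by
    refine isEnclosure_iff.2 fun i x hx => ⟨?_, hV.invariant i x hx.2⟩
    obtain ⟨⟨z, hz, rfl⟩, hzV⟩ := hx
    refine ⟨_, hY i z hz, ?_⟩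
    rw [Submodule.subtype_apply, restrictKraus_eq, coe_compress_apply]
    exact Submodule.starProjection_eq_self_iff.2 (hVW (hV.invariant i _ hzV))
  rcases hV.2.2 _ h1 inf_le_right with h | h
  · have : (y : H) ∈ Y.map W.subtype ⊓ V := ⟨⟨y, hyY, rfl⟩, hyV⟩
    rw [h, Submodule.mem_bot] at this
    exact absurd (Subtype.ext this) hy0
  · exact inf_eq_right.1 h

/-- Both spectral radii attached to a minimal enclosure agree near `0` with a `C²` function. -/
lemma exists_radius_branch (s : Fin v → EuclideanSpace ℝ (Fin d))
    (hL : ∑ i, adjoint (L i) * L i = 1) (hV : IsMinimalEnclosure (krausMap L) V) :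
    ∃ r : EuclideanSpace ℝ (Fin d) → ℝ, ContDiffAt ℝ 2 r 0 ∧
      tildeRadius s L V =ᶠ[𝓝 0] r ∧ restrictRadius s L V =ᶠ[𝓝 0] r := by
  obtain ⟨W, hW⟩ : ∃ W, W = supp (absorption L V) := ⟨_, rfl⟩
  have hA := isPositive_absorption hL hV.invariant
  have hVW : V ≤ W := hW ▸ le_supp_absorption hL hV.invariant
  have : Nontrivial V := Submodule.nontrivial_iff_ne_bot.2 hV.2.1
  have : Nontrivial W := Submodule.nontrivial_iff_ne_bot.2 fun h => hV.2.1
    (le_bot_iff.1 (h ▸ hVW))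
  have hpos : ∀ y : W, y ≠ 0 → 0 < (⟪y, compress W (absorption L V) y⟫_ℂ).re := by
    intro y hy
    rw [inner_compress]
    exact absorption_pos hL hV.invariant (hW ▸ y.2) (by simpa using hy)
  have hfix : dualKrausMap (restrictKraus L W) (compress W (absorption L V)) =
      compress W (absorption L V) := by
    have := dualKrausMap_restrictKraus_absorption hL hV.invariant
    rwa [← hW] at this
  -- Any two nonzero invariant subspaces of the compression to `W` meet because both contain `V`.
  obtain ⟨r, hr, hev⟩ := exists_posDef_branch s (E := W) (K := restrictKraus L W)
    (isPositive_compress W hA).isSelfAdjoint hpos hfix (by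
      intro Y Z hY hZ hY0 hZ0
      obtain ⟨x, hx, hx0⟩ := (Submodule.ne_bot_iff _).1 hV.2.1
      obtain ⟨y, hy, hyx⟩ := hV.le_map_of_invariant hL hW hY hY0 hx
      obtain ⟨z, hz, hzx⟩ := hV.le_map_of_invariant hL hW hZ hZ0 hx
      have hyz : y = z := Subtype.ext (hyx.trans hzx.symm)
      refine (Submodule.ne_bot_iff _).2 ⟨y, ⟨hy, hyz ▸ hz⟩, ?_⟩
      rintro rfl
      exact hx0 hyx.symm)
  refine ⟨r, hr, ?_, ?_⟩
  · filter_upwards [hev] with u ⟨x, hx, hxu⟩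
    have h1 : deform s u (tildeKraus L V) =
        fun i => extend W (deform s u (restrictKraus L W) i) := by
      funext i
      simp only [deform, extend_smul, restrictKraus_eq, extend_compress_eq, tildeKraus, hW]
    rw [tildeRadius, radius, h1]
    exact spectralRadius_krausMap_extend_eq W hx hxu
  · filter_upwards [hev] with u ⟨x, hx, hxu⟩
    rw [restrictRadius, radius]
    have hinv : ∀ i, ∀ y ∈ V, deform s u L i y ∈ V := fun i y hy =>
      V.smul_mem _ (hV.invariant i y hy)
    -- The eigenvector found on `W` also serves on `V`: the deformed operators preserve `V`, so its
    -- eigenvalue equation can be tested on vectors of `V` alone.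
    refine spectralRadius_krausMap_eq (X := compress V (extend W x)) (fun y hy => ?_) ?_
    · have h1 := hx ⟨y, hVW y.2⟩ (by simpa using hy)
      rw [inner_compress]
      have h2 := extend_apply_coe W x ⟨y, hVW y.2⟩
      rw [h2]
      exact h1
    · rw [deform_restrictKraus, dualKrausMap_restrictKraus_of_invariant hinv]
      refine op_ext_inner fun a b => ?_
      rw [deform_restrictKraus] at hxu
      have h2 : ∀ (i) (y : W), y.1 ∈ V →
          (restrictKraus (deform s u L) W i y : H) = deform s u L i y := fun i y hy => by
        rw [restrictKraus_eq, coe_compress_apply]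
        exact Submodule.starProjection_eq_self_iff.2 (hVW (hinv i _ hy))
      have h3 := congrArg (fun T : W →L[ℂ] W => ⟪(⟨a, hVW a.2⟩ : W), T ⟨b, hVW b.2⟩⟫_ℂ) hxu
      simp only [inner_dualKrausMap] at h3
      rw [← compress_smul, ← extend_smul, inner_compress, inner_compress, inner_dualKrausMap]
      have h4 := extend_apply_coe W ((r u : ℂ) • x) ⟨b, hVW b.2⟩
      rw [h4]
      refine Eq.trans (Finset.sum_congr rfl fun i _ => ?_) h3
      have h5 := extend_apply_coe W x (restrictKraus (deform s u L) W i ⟨b, hVW b.2⟩)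
      rw [h2 i _ b.2] at h5
      rw [h5, ← h2 i ⟨a, hVW a.2⟩ a.2]
      rfl

end Radius

/-! ### The covariance matrix of a `C²` function -/

section Covariance

variable {d : ℕ}

lemma IsCovariance.congr {r r' : EuclideanSpace ℝ (Fin d) → ℝ} {D : Matrix (Fin d) (Fin d) ℝ}
    (h : IsCovariance r D) (hr : r' =ᶠ[𝓝 0] r) : IsCovariance r' D := by
  refine ⟨h.1.congr_of_eventuallyEq hr, h.2.1, fun u => ?_⟩
  have h1 : (fun t : ℝ => r' (t • u)) =ᶠ[𝓝 0] fun t : ℝ => r (t • u) := by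
    have hc : Tendsto (fun t : ℝ => t • u) (𝓝 0) (𝓝 0) := by
      have : Continuous fun t : ℝ => t • u := by fun_prop
      simpa using this.tendsto 0
    exact hc.eventually hr
  rw [h.2.2 u, h1.deriv_eq, h1.iteratedDeriv_eq]

/-- Polarisation: a symmetric matrix is determined by its quadratic form. -/
lemma isCovariance_unique {r : EuclideanSpace ℝ (Fin d) → ℝ} {D D' : Matrix (Fin d) (Fin d) ℝ}
    (h : IsCovariance r D) (h' : IsCovariance r D') : D = D' := by
  have hq : ∀ x : Fin d → ℝ, x ⬝ᵥ (D - D').mulVec x = 0 := fun x => by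
    have h1 := (h.2.2 (WithLp.toLp 2 x)).trans (h'.2.2 (WithLp.toLp 2 x)).symm
    simp only at h1
    rw [Matrix.sub_mulVec, dotProduct_sub, h1, sub_self]
  have hs : (D - D').IsSymm := h.2.1.sub h'.2.1
  rw [← sub_eq_zero]
  generalize D - D' = B at hq hs
  have he : ∀ i j, Pi.single i 1 ⬝ᵥ B.mulVec (Pi.single j 1) = B i j := fun i j => by simp
  ext i j
  have h1 := hq (Pi.single i 1 + Pi.single j 1)
  simp only [Matrix.mulVec_add, dotProduct_add, add_dotProduct, he] at h1
  have h2 := hq (Pi.single i 1)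
  have h3 := hq (Pi.single j 1)
  rw [he] at h2 h3
  have h4 := hs.apply i j
  simp only [Matrix.zero_apply]
  linarith

lemma clm_apply_eq_sum {F : Type*} [NormedAddCommGroup F] [NormedSpace ℝ F]
    (l : EuclideanSpace ℝ (Fin d) →L[ℝ] F) (u : EuclideanSpace ℝ (Fin d)) :
    l u = ∑ i, u i • l (EuclideanSpace.single i 1) := by
  have hsum : u = ∑ i, u i • (EuclideanSpace.single i 1 : EuclideanSpace ℝ (Fin d)) := by
    ext j
    simp [Pi.single_apply]
  conv_lhs => rw [hsum]
  rw [map_sum]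
  exact Finset.sum_congr rfl fun i _ => map_smul _ _ _

lemma deriv_line_and_iteratedDeriv_two_line {F : Type*} [NormedAddCommGroup F] [NormedSpace ℝ F]
    {r : F → ℝ} (hr : ContDiffAt ℝ 2 r 0) (u : F) :
    deriv (fun t : ℝ => r (t • u)) 0 = fderiv ℝ r 0 u ∧
      iteratedDeriv 2 (fun t : ℝ => r (t • u)) 0 = fderiv ℝ (fderiv ℝ r) 0 u u := by
  have hline : ∀ t : ℝ, HasDerivAt (fun t : ℝ => t • u) u t := fun t => by
    simpa using (hasDerivAt_id t).smul_const u
  have hdiff : ∀ᶠ x in 𝓝 (0 : F), DifferentiableAt ℝ r x :=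
    (hr.eventually (by simp)).mono fun x hx => hx.differentiableAt two_ne_zero
  have hc : Tendsto (fun t : ℝ => t • u) (𝓝 0) (𝓝 0) := by
    simpa using (hline 0).continuousAt.tendsto
  have hd1 : deriv (fun t : ℝ => r (t • u)) =ᶠ[𝓝 0] fun t => fderiv ℝ r (t • u) u := by
    filter_upwards [hc.eventually hdiff] with t ht
    exact (ht.hasFDerivAt.comp_hasDerivAt t (hline t)).deriv
  have hfd : DifferentiableAt ℝ (fderiv ℝ r) 0 :=
    (hr.fderiv_right (m := 1) (by norm_num)).differentiableAt one_ne_zero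
  constructor
  · rw [hd1.eq_of_nhds, zero_smul]
  · rw [iteratedDeriv_succ, iteratedDeriv_one, hd1.deriv_eq]
    have h1 : HasDerivAt (fun t : ℝ => fderiv ℝ r (t • u)) (fderiv ℝ (fderiv ℝ r) 0 u) 0 :=
      HasFDerivAt.comp_hasDerivAt (l := fderiv ℝ r) (0 : ℝ)
        (by rw [zero_smul]; exact hfd.hasFDerivAt) (hline 0)
    have h2 : HasDerivAt (fun t : ℝ => fderiv ℝ r (t • u) u) (fderiv ℝ (fderiv ℝ r) 0 u u) 0 :=
      (ContinuousLinearMap.apply ℝ ℝ u).hasFDerivAt.comp_hasDerivAt (0 : ℝ) h1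
    exact h2.deriv

/-- The matrix is the Hessian minus the outer square of the gradient; symmetry of the second
derivative makes it symmetric. -/
lemma exists_isCovariance {r : EuclideanSpace ℝ (Fin d) → ℝ} (hr : ContDiffAt ℝ 2 r 0) :
    ∃ D, IsCovariance r D := by
  let e : Fin d → EuclideanSpace ℝ (Fin d) := fun i => EuclideanSpace.single i 1
  have hsymm : IsSymmSndFDerivAt ℝ r 0 := hr.isSymmSndFDerivAt (by simp)
  have hder := deriv_line_and_iteratedDeriv_two_line hr
  unfold IsSymmSndFDerivAt at hsymm
  generalize fderiv ℝ (fderiv ℝ r) 0 = B at hsymm hder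
  generalize fderiv ℝ r 0 = l at hder
  refine ⟨Matrix.of fun i j => B (e i) (e j) - l (e i) * l (e j), hr, ?_, fun u => ?_⟩
  · ext i j
    simp only [Matrix.transpose_apply, Matrix.of_apply]
    rw [hsymm, mul_comm]
  · rw [(hder u).1, (hder u).2]
    have hlu : l u = ∑ i, u i * l (e i) := clm_apply_eq_sum l u
    have hBu : B u u = ∑ i, ∑ j, u i * (u j * B (e i) (e j)) := by
      have h1 : B u = ∑ i, u i • B (e i) := clm_apply_eq_sum B u
      rw [h1, sum_apply]
      refine Finset.sum_congr rfl fun i _ => ?_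
      rw [← Finset.mul_sum, smul_apply, smul_eq_mul]
      exact congrArg _ (clm_apply_eq_sum (B (e i)) u)
    rw [hBu, hlu, sq, Finset.sum_mul_sum, ← Finset.sum_sub_distrib]
    simp only [dotProduct, Matrix.mulVec, Matrix.of_apply, Finset.mul_sum]
    refine Finset.sum_congr rfl fun i _ => ?_
    rw [← Finset.sum_sub_distrib]
    refine Finset.sum_congr rfl fun j _ => ?_
    ring

end Covariance

/-! ### Existence, faithfulness and uniqueness of invariant states -/

section InvariantState

variable {E : Type*} [NormedAddCommGroup E] [InnerProductSpace ℂ E] [CompleteSpace E]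
  [FiniteDimensional ℂ E] {v : ℕ} {K : Fin v → E →L[ℂ] E}

lemma tr_krausMap (h1 : dualKrausMap K 1 = 1) (σ : E →L[ℂ] E) : tr (krausMap K σ) = tr σ := by
  have := tr_krausMap_mul K σ 1
  rwa [h1, mul_one, mul_one] at this

/-- A trace-preserving Kraus map has an invariant state, by averaging along an orbit. -/
lemma exists_invariant_state [Nontrivial E] (h1 : dualKrausMap K 1 = 1) :
    ∃ τ : E →L[ℂ] E, τ.IsPositive ∧ tr τ = 1 ∧ krausMap K τ = τ := by
  have : ProperSpace (E →L[ℂ] E) := FiniteDimensional.proper ℂ _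
  have hN : 0 < Module.finrank ℂ E := Module.finrank_pos
  let ω : E →L[ℂ] E := (((Module.finrank ℂ E : ℝ)⁻¹ : ℝ) : ℂ) • 1
  have hω : ω.IsPositive :=
    ContinuousLinearMap.isPositive_one.smul_of_nonneg (by
      rw [Complex.zero_le_real]; positivity)
  have htrω : tr ω = 1 := by
    have h2 : tr (1 : E →L[ℂ] E) = Module.finrank ℂ E := LinearMap.trace_one ℂ E
    rw [tr_smul, h2]
    push_cast
    exact inv_mul_cancel₀ (by exact_mod_cast hN.ne')
  let x : ℕ → E →L[ℂ] E := fun n => (krausMap K ^ n) ω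
  have hxs : ∀ n, krausMap K (x n) = x (n + 1) := fun n => by
    simp only [x]; rw [pow_succ']; rfl
  have hx : ∀ n, (x n).IsPositive ∧ tr (x n) = 1 := by
    intro n
    induction n with
    | zero => exact ⟨hω, htrω⟩
    | succ n ih =>
      rw [← hxs]
      exact ⟨krausMap_isPositive K ih.1, by rw [tr_krausMap h1, ih.2]⟩
  let c : ℕ → E →L[ℂ] E := fun n =>
    ((((n : ℝ) + 1)⁻¹ : ℝ) : ℂ) • ∑ k ∈ Finset.range (n + 1), x k
  have hcpos : ∀ n, (c n).IsPositive := fun n =>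
    (ContinuousLinearMap.isPositive_sum _ fun k _ => (hx k).1).smul_of_nonneg (by
      rw [Complex.zero_le_real]; positivity)
  have hctr : ∀ n, tr (c n) = 1 := fun n => by
    have h3 : ((n : ℂ) + 1) ≠ 0 := by exact_mod_cast n.succ_ne_zero
    simp only [c]
    rw [tr_smul, tr_sum, Finset.sum_congr rfl fun k _ => (hx k).2]
    simp [h3]
  have hxn : ∀ n, ‖x n‖ ≤ 1 := fun n => by
    simpa [(hx n).2] using norm_le_tr (hx n).1
  have hcn : ∀ n, ‖c n‖ ≤ 1 := fun n => by
    simpa [hctr n] using norm_le_tr (hcpos n)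
  have hdiff : ∀ n, ‖krausMap K (c n) - c n‖ ≤ 2 * (1 / ((n : ℝ) + 1)) := by
    intro n
    -- Telescoping: the map moves a Cesàro mean only by its endpoint terms, so every limit point of
    -- the means is fixed.
    have h4 : krausMap K (c n) - c n = ((((n : ℝ) + 1)⁻¹ : ℝ) : ℂ) • (x (n + 1) - x 0) := by
      simp only [c]
      rw [map_smul, map_sum, ← smul_sub, ← Finset.sum_sub_distrib]
      simp only [hxs]
      rw [Finset.sum_range_sub]
    rw [h4, norm_smul, Complex.norm_real, Real.norm_of_nonneg (by positivity), one_div, mul_comm]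
    have := (norm_sub_le (x (n + 1)) (x 0)).trans (add_le_add (hxn _) (hxn _))
    gcongr
    linarith
  obtain ⟨τ, -, φ, hφ, hlim⟩ := tendsto_subseq_of_bounded (x := c)
    (Metric.isBounded_closedBall (x := (0 : E →L[ℂ] E)) (r := 1)) fun n => by
      simpa using hcn n
  refine ⟨τ, isPositive_of_tendsto hlim fun n => hcpos _, ?_, ?_⟩
  · have hc : Continuous fun y : E →L[ℂ] E => tr y :=
      (LinearMap.continuous_of_finiteDimensional
        { toFun := fun y : E →L[ℂ] E => tr y, map_add' := tr_add, map_smul' := tr_smul })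
    refine tendsto_nhds_unique ((hc.tendsto τ).comp hlim) ?_
    exact tendsto_const_nhds.congr fun n => (hctr _).symm
  · have h5 : Tendsto (fun n => krausMap K (c (φ n)) - c (φ n)) atTop (𝓝 0) := by
      have h6 : Tendsto (fun n : ℕ => 2 * (1 / ((n : ℝ) + 1))) atTop (𝓝 0) := by
        simpa using (tendsto_one_div_add_atTop_nhds_zero_nat (𝕜 := ℝ)).const_mul 2
      exact squeeze_zero_norm (fun n => hdiff (φ n)) (h6.comp hφ.tendsto_atTop)
    have h7 := (((continuous_krausMap K).tendsto τ).comp hlim).sub hlim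
    exact sub_eq_zero.1 (tendsto_nhds_unique h7 h5)

/-- A nonzero positive fixed point of an irreducible Kraus map is faithful. -/
lemma pos_of_fixed_of_irreducible
    (hirr : ∀ Y : Submodule ℂ E, (∀ i, ∀ y ∈ Y, K i y ∈ Y) → Y = ⊥ ∨ Y = ⊤)
    {τ : E →L[ℂ] E} (hτ : τ.IsPositive) (hfix : krausMap K τ = τ) (h0 : τ ≠ 0) {y : E}
    (hy : y ≠ 0) : 0 < (⟪y, τ y⟫_ℂ).re := by
  refine lt_of_le_of_ne (inner_self_re_nonneg_of_isPositive hτ y) fun h => ?_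
  have hτy := apply_eq_zero_of_isPositive hτ h.symm
  -- As a fixed point of the dual of the adjoint family, `τ` has a kernel invariant under every
  -- `adjoint (K i)`; hence its support is invariant under every `K i`.
  rcases hirr (supp τ) fun i a ha z hz => by
    rw [← ContinuousLinearMap.adjoint_inner_left]
    refine ha _ ?_
    have hd : dualKrausMap (fun i => adjoint (K i)) τ = τ := by simpa [dualKrausMap] using hfix
    exact apply_kraus_eq_zero hτ hd (show τ z = 0 from hz) i with h1 | h1
  · apply h0
    ext z
    refine mem_supp_orthogonal.1 ?_
    rw [h1, Submodule.bot_orthogonal_eq_top]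
    trivial
  · have h2 : y ∈ (supp τ)ᗮ := mem_supp_orthogonal.2 hτy
    rw [h1, Submodule.top_orthogonal_eq_bot] at h2
    exact hy h2

/-- The invariant state of an irreducible Kraus map is unique. -/
lemma invariant_state_unique [Nontrivial E]
    (hirr : ∀ Y : Submodule ℂ E, (∀ i, ∀ y ∈ Y, K i y ∈ Y) → Y = ⊥ ∨ Y = ⊤)
    {τ σ : E →L[ℂ] E} (hτ : τ.IsPositive) (hτf : krausMap K τ = τ) (hτ1 : tr τ = 1)
    (hσ : σ.IsPositive) (hσf : krausMap K σ = σ) (hσ1 : tr σ = 1) : σ = τ := by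
  have hne : τ ≠ 0 := by
    rintro rfl
    simp [tr] at hτ1
  obtain ⟨M, y, hy, h1, h2⟩ := exists_rayleigh_max σ fun y hy =>
    pos_of_fixed_of_irreducible hirr hτ hτf hne hy
  have hT : ((M : ℂ) • τ - σ).IsPositive := by
    refine isPositive_of_forall_re ?_ fun z => ?_
    · exact (IsSelfAdjoint.smul (by simp [IsSelfAdjoint]) hτ.isSelfAdjoint).sub hσ.isSelfAdjoint
    · rw [sub_apply, inner_sub_right, Complex.sub_re, smul_re_inner]
      exact sub_nonneg.2 (h2 z)
  -- The positive fixed point `M τ - σ` degenerates at `y`, so it is not faithful and must vanish.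
  -- Comparing traces then gives `M = 1`.
  have hT0 : (M : ℂ) • τ - σ = 0 := by
    by_contra hT0
    have := pos_of_fixed_of_irreducible hirr hT (by rw [map_sub, map_smul, hτf, hσf]) hT0 hy
    rw [sub_apply, inner_sub_right, Complex.sub_re, smul_re_inner, h1, sub_self] at this
    exact lt_irrefl _ this
  have hM : (M : ℂ) = 1 := by
    have := congrArg tr (sub_eq_zero.1 hT0)
    rwa [tr_smul, hτ1, hσ1, mul_one] at this
  rw [hM, one_smul] at hT0
  exact (sub_eq_zero.1 hT0).symm

end InvariantState

/-! ### The mean of a minimal enclosure -/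

section Mean

variable {H : Type*} [NormedAddCommGroup H] [InnerProductSpace ℂ H] [CompleteSpace H]
  [FiniteDimensional ℂ H] {d v : ℕ} {L : Fin v → H →L[ℂ] H} {V : Submodule ℂ H}

lemma IsMinimalEnclosure.irreducible (hV : IsMinimalEnclosure (krausMap L) V)
    (Y : Submodule ℂ V) (hY : ∀ i, ∀ y ∈ Y, restrictKraus L V i y ∈ Y) : Y = ⊥ ∨ Y = ⊤ := by
  have h1 : IsEnclosure (krausMap L) (Y.map V.subtype) := by
    refine isEnclosure_iff.2 ?_
    rintro i _ ⟨y, hy, rfl⟩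
    exact ⟨_, hY i y hy, coe_restrictKraus_apply hV.invariant i y⟩
  rcases hV.2.2 _ h1 (Submodule.map_subtype_le V Y) with h | h
  · exact Or.inl (Submodule.map_injective_of_injective V.injective_subtype
      (by rw [h, Submodule.map_bot]))
  · refine Or.inr (Submodule.map_injective_of_injective V.injective_subtype ?_)
    rw [h, Submodule.map_subtype_top]

lemma isInvariantStateOn_extend (hV : IsMinimalEnclosure (krausMap L) V) {τ : V →L[ℂ] V}
    (hτ : τ.IsPositive) (hτ1 : tr τ = 1) (hτf : krausMap (restrictKraus L V) τ = τ) :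
    IsInvariantStateOn (krausMap L) V (extend V τ) := by
  refine ⟨isPositive_extend V hτ, by rw [tr_extend, hτ1],
    by rw [krausMap_extend hV.invariant, hτf], le_antisymm ?_ ?_⟩
  · exact supp_le_iff.2 fun z hz => extend_apply_of_mem_orthogonal V τ hz
  · have hne : τ ≠ 0 := by
      rintro rfl
      simp [tr] at hτ1
    have key : (supp (extend V τ))ᗮ ≤ Vᗮ := fun z hz => by
      rw [← Submodule.orthogonalProjectionOnto_eq_zero_iff]
      by_contra h0
      have h1 := pos_of_fixed_of_irreducible hV.irreducible hτ hτf hne h0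
      have h2 : (τ (V.orthogonalProjectionOnto z) : H) = 0 := mem_supp_orthogonal.1 hz
      rw [Submodule.coe_eq_zero.1 h2] at h1
      simp at h1
    have := Submodule.orthogonal_le key
    rwa [Submodule.orthogonal_orthogonal, Submodule.orthogonal_orthogonal] at this

lemma eq_extend_of_isInvariantStateOn (hV : IsMinimalEnclosure (krausMap L) V) {τ : V →L[ℂ] V}
    (hτ : τ.IsPositive) (hτ1 : tr τ = 1) (hτf : krausMap (restrictKraus L V) τ = τ)
    {σ : H →L[ℂ] H} (hσ : IsInvariantStateOn (krausMap L) V σ) : σ = extend V τ := by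
  have : Nontrivial V := Submodule.nontrivial_iff_ne_bot.2 hV.2.1
  obtain ⟨hσp, hσ1, hσf, hσV⟩ := hσ
  have h0 := supp_le_iff.1 hσV.le
  have h1 : ∀ a, σ (V.starProjection a) = σ a := fun a => by
    have := h0 _ (V.sub_starProjection_mem_orthogonal a)
    rw [map_sub, sub_eq_zero] at this
    exact this.symm
  have h2 : extend V (compress V σ) = σ := by
    rw [extend_compress_eq]
    refine op_ext_inner fun a b => ?_
    rw [mul_apply_eq_comp, mul_apply_eq_comp, h1, ← Submodule.inner_starProjection_left_eq_right,
      ← hσp.inner_left_eq_inner_right, h1, hσp.inner_left_eq_inner_right]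
  have h3 : compress V σ = τ := by
    refine invariant_state_unique hV.irreducible hτ hτf hτ1 (isPositive_compress V hσp) ?_ ?_
    · apply extend_injective V
      rw [← krausMap_extend hV.invariant, h2, hσf]
    · rw [← tr_extend, h2, hσ1]
  rw [← h3, h2]

/-- The mean of a minimal enclosure, computed from the invariant state of the restricted
channel. -/
lemma isMean_of_invariant_state (s : Fin v → EuclideanSpace ℝ (Fin d))
    (hV : IsMinimalEnclosure (krausMap L) V) {τ : V →L[ℂ] V}
    (hτ : τ.IsPositive) (hτ1 : tr τ = 1) (hτf : krausMap (restrictKraus L V) τ = τ) :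
    IsMean s L V (∑ i, (tr (restrictKraus L V i * τ * adjoint (restrictKraus L V i))).re • s i) := by
  refine ⟨⟨_, isInvariantStateOn_extend hV hτ hτ1 hτf,
    fun σ hσ => eq_extend_of_isInvariantStateOn hV hτ hτ1 hτf hσ⟩, fun σ hσ => ?_⟩
  rw [eq_extend_of_isInvariantStateOn hV hτ hτ1 hτf hσ]
  simp only [kraus_mul_extend_mul_adjoint hV.invariant, tr_extend]

lemma IsMinimalEnclosure.exists_invariant_state (hL : ∑ i, adjoint (L i) * L i = 1)
    (hV : IsMinimalEnclosure (krausMap L) V) :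
    ∃ τ : V →L[ℂ] V, τ.IsPositive ∧ tr τ = 1 ∧ krausMap (restrictKraus L V) τ = τ := by
  have : Nontrivial V := Submodule.nontrivial_iff_ne_bot.2 hV.2.1
  exact OQW.exists_invariant_state (dualKrausMap_restrictKraus_one hV.invariant hL)

end Mean

/-! ### Unitary equivalence of the enclosures in a block -/

section Equivalence

variable {H : Type*} [NormedAddCommGroup H] [InnerProductSpace ℂ H] [CompleteSpace H]
  [FiniteDimensional ℂ H] {d v : ℕ}

/-- The channels restricted to `V` and `W` are unitarily equivalent. -/
def RestrictEquiv (L : Fin v → H →L[ℂ] H) (V W : Submodule ℂ H) : Prop :=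
  ∃ U : V ≃ₗᵢ[ℂ] W, ∀ i a, U (restrictKraus L V i a) = restrictKraus L W i (U a)

variable {L : Fin v → H →L[ℂ] H} {V W Z : Submodule ℂ H}

lemma RestrictEquiv.refl (L : Fin v → H →L[ℂ] H) (V : Submodule ℂ H) : RestrictEquiv L V V :=
  ⟨LinearIsometryEquiv.refl ℂ V, fun _ _ => rfl⟩

lemma RestrictEquiv.symm (h : RestrictEquiv L V W) : RestrictEquiv L W V := by
  obtain ⟨U, hU⟩ := h
  refine ⟨U.symm, fun i a => U.injective ?_⟩
  rw [hU, U.apply_symm_apply, U.apply_symm_apply]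

lemma RestrictEquiv.trans (h : RestrictEquiv L V W) (h' : RestrictEquiv L W Z) :
    RestrictEquiv L V Z := by
  obtain ⟨U, hU⟩ := h
  obtain ⟨U', hU'⟩ := h'
  refine ⟨U.trans U', fun i a => ?_⟩
  simp only [LinearIsometryEquiv.trans_apply, hU, hU']

section Conj

variable {E F : Type*} [NormedAddCommGroup E] [InnerProductSpace ℂ E] [CompleteSpace E]
  [NormedAddCommGroup F] [InnerProductSpace ℂ F] [CompleteSpace F]

/-- Conjugation of operators by a unitary. -/
def unitaryConj (U : E ≃ₗᵢ[ℂ] F) (x : E →L[ℂ] E) : F →L[ℂ] F :=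
  (U : E →L[ℂ] F) ∘L x ∘L (U.symm : F →L[ℂ] E)

variable (U : E ≃ₗᵢ[ℂ] F)

lemma unitaryConj_apply (x : E →L[ℂ] E) (a : F) : unitaryConj U x a = U (x (U.symm a)) := rfl

lemma inner_unitaryConj (x : E →L[ℂ] E) (a b : F) :
    ⟪a, unitaryConj U x b⟫_ℂ = ⟪U.symm a, x (U.symm b)⟫_ℂ := by
  rw [unitaryConj_apply, ← U.symm.inner_map_map, U.symm_apply_apply]

lemma unitaryConj_mul (x y : E →L[ℂ] E) :
    unitaryConj U (x * y) = unitaryConj U x * unitaryConj U y := by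
  ext a; simp [unitaryConj_apply]

lemma adjoint_unitaryConj (x : E →L[ℂ] E) :
    adjoint (unitaryConj U x) = unitaryConj U (adjoint x) := by
  refine op_ext_inner fun a b => ?_
  rw [ContinuousLinearMap.adjoint_inner_right, inner_unitaryConj,
    ContinuousLinearMap.adjoint_inner_right, ← inner_conj_symm, inner_unitaryConj,
    inner_conj_symm]

lemma unitaryConj_injective : Function.Injective (unitaryConj U) := by
  intro x y h
  ext a
  have := congrArg (fun T : F →L[ℂ] F => U.symm (T (U a))) h
  simpa [unitaryConj_apply] using this

lemma krausMap_unitaryConj {K : Fin v → E →L[ℂ] E} {K' : Fin v → F →L[ℂ] F}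
    (hK : ∀ i, K' i = unitaryConj U (K i)) (σ : E →L[ℂ] E) :
    krausMap K' (unitaryConj U σ) = unitaryConj U (krausMap K σ) := by
  ext a
  simp [krausMap_apply, hK, adjoint_unitaryConj, unitaryConj_apply, sum_apply]

variable [FiniteDimensional ℂ E] [FiniteDimensional ℂ F]

lemma tr_unitaryConj (x : E →L[ℂ] E) : tr (unitaryConj U x) = tr x := by
  rw [unitaryConj, tr_comp_comm, ContinuousLinearMap.comp_assoc]
  congr 1
  ext a
  simp

/-- Conjugation by `U` carries eigenvectors to eigenvectors; equality follows by applying this to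
the inverse as well. -/
lemma spectralRadius_krausMap_le {K : Fin v → E →L[ℂ] E} {K' : Fin v → F →L[ℂ] F}
    (hK : ∀ i, K' i = unitaryConj U (K i)) :
    spectralRadius ℂ (krausMap K) ≤ spectralRadius ℂ (krausMap K') := by
  refine biSup_mono fun μ hμ => ?_
  obtain ⟨σ, hσ⟩ := (Module.End.hasEigenvalue_iff_mem_spectrum.2 hμ).exists_hasEigenvector
  refine (Module.End.hasEigenvalue_of_hasEigenvector (x := unitaryConj U σ)
    (Module.End.hasEigenvector_iff.2
      ⟨Module.End.mem_eigenspace_iff.2 ?_, fun h0 => hσ.2 ?_⟩)).mem_spectrum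
  · rw [krausMap_unitaryConj U hK, hσ.apply_eq_smul]
    ext a; simp [unitaryConj_apply]
  · refine unitaryConj_injective U (h0.trans ?_)
    ext a; simp [unitaryConj_apply]

lemma isPositive_unitaryConj {x : E →L[ℂ] E} (hx : x.IsPositive) :
    (unitaryConj U x).IsPositive := by
  refine isPositive_of_forall_re ?_ fun a => ?_
  · rw [IsSelfAdjoint, ContinuousLinearMap.star_eq_adjoint, adjoint_unitaryConj,
      ← ContinuousLinearMap.star_eq_adjoint, hx.isSelfAdjoint.star_eq]
  · rw [inner_unitaryConj]
    exact inner_self_re_nonneg_of_isPositive hx _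

end Conj

lemma restrictKraus_eq_unitaryConj {U : V ≃ₗᵢ[ℂ] W}
    (hU : ∀ i a, U (restrictKraus L V i a) = restrictKraus L W i (U a)) (i : Fin v) :
    restrictKraus L W i = unitaryConj U (restrictKraus L V i) := by
  ext a
  rw [unitaryConj_apply, hU, U.apply_symm_apply]

lemma RestrictEquiv.restrictRadius_le (h : RestrictEquiv L V W)
    (s : Fin v → EuclideanSpace ℝ (Fin d)) (u : EuclideanSpace ℝ (Fin d)) :
    spectralRadius ℂ (krausMap (deform s u (restrictKraus L V))) ≤
      spectralRadius ℂ (krausMap (deform s u (restrictKraus L W))) := by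
  obtain ⟨U, hU⟩ := h
  refine spectralRadius_krausMap_le U fun i => ?_
  ext a
  simp [deform, restrictKraus_eq_unitaryConj hU, unitaryConj_apply]

lemma RestrictEquiv.restrictRadius_eq (h : RestrictEquiv L V W)
    (s : Fin v → EuclideanSpace ℝ (Fin d)) : restrictRadius s L V = restrictRadius s L W := by
  funext u
  rw [restrictRadius, restrictRadius, radius, radius,
    le_antisymm (h.restrictRadius_le s u) (h.symm.restrictRadius_le s u)]

/-- Schur's lemma for an irreducible family of Kraus operators. -/
lemma exists_forall_apply_eq_smul {E : Type*} [NormedAddCommGroup E] [InnerProductSpace ℂ E]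
    [FiniteDimensional ℂ E] [Nontrivial E] {K : Fin v → E →L[ℂ] E}
    (hirr : ∀ Y : Submodule ℂ E, (∀ i, ∀ y ∈ Y, K i y ∈ Y) → Y = ⊥ ∨ Y = ⊤)
    {G : E →L[ℂ] E} (hG : ∀ i a, G (K i a) = K i (G a)) : ∃ c : ℂ, ∀ a, G a = c • a := by
  obtain ⟨c, hc⟩ := Module.End.exists_eigenvalue (G : Module.End ℂ E)
  refine ⟨c, fun a => ?_⟩
  have h1 : Module.End.eigenspace (G : Module.End ℂ E) c = ⊤ := by
    refine (hirr _ fun i y hy => ?_).resolve_left hc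
    rw [Module.End.mem_eigenspace_iff, ContinuousLinearMap.coe_coe] at hy ⊢
    rw [hG, hy, map_smul]
  have h2 : a ∈ Module.End.eigenspace (G : Module.End ℂ E) c := h1 ▸ Submodule.mem_top
  exact Module.End.mem_eigenspace_iff.1 h2

/-- The projection between two minimal enclosures intertwines the restricted channels. -/
lemma projection_intertwines (hL : ∑ i, adjoint (L i) * L i = 1)
    (hV : IsMinimalEnclosure (krausMap L) V) (hW : IsMinimalEnclosure (krausMap L) W)
    (i : Fin v) (a : V) :
    W.orthogonalProjectionOnto (restrictKraus L V i a : H) =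
      restrictKraus L W i (W.orthogonalProjectionOnto (a : H)) := by
  obtain ⟨τ₁, hp₁, ht₁, hf₁⟩ := hV.exists_invariant_state hL
  obtain ⟨τ₂, hp₂, ht₂, hf₂⟩ := hW.exists_invariant_state hL
  obtain ⟨hP₁, -, hF₁, hS₁⟩ := isInvariantStateOn_extend hV hp₁ ht₁ hf₁
  obtain ⟨hP₂, -, hF₂, -⟩ := isInvariantStateOn_extend hW hp₂ ht₂ hf₂
  -- A positive fixed point whose support contains `V`.
  set τ := extend V τ₁ + extend W τ₂ with hτdef
  have hτ : τ.IsPositive := hP₁.add hP₂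
  have hτf : krausMap L τ = τ := by rw [hτdef, map_add, hF₁, hF₂]
  have hker : ∀ z, τ z = 0 → z ∈ Vᗮ := fun z hz => by
    have h1 : (⟪z, τ z⟫_ℂ).re = 0 := by rw [hz]; simp
    rw [hτdef, add_apply, inner_add_right, Complex.add_re] at h1
    have h2 := inner_self_re_nonneg_of_isPositive hP₁ z
    have h3 := inner_self_re_nonneg_of_isPositive hP₂ z
    rw [← hS₁]
    exact mem_supp_orthogonal.2 (apply_eq_zero_of_isPositive hP₁ (by linarith))
  let B : Fin v → H →L[ℂ] H := fun i => W.starProjection * L i * (1 - W.starProjection)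
  -- This trace is the expectation in `τ` of `Φ*(p_W) - p_W`, zero by invariance of `τ`. Each `B i`
  -- therefore vanishes on the support of `τ`, in particular on `V`.
  have htr : tr (krausMap B τ) = 0 := by
    have h1 := tr_krausMap_mul B τ 1
    rw [mul_one, ← dualKrausMap_starProjection_sub hL hW.invariant, mul_sub, tr_sub,
      ← tr_krausMap_mul, hτf, sub_self] at h1
    exact h1
  have hB0 : krausMap B τ = 0 :=
    eq_zero_of_tr_re_eq_zero (krausMap_isPositive B hτ) (by rw [htr]; rfl)
  have hBV : B i a = 0 := by
    refine ext_inner_left ℂ fun z => ?_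
    rw [inner_zero_right, ← ContinuousLinearMap.adjoint_inner_left]
    have h1 : (⟪z, krausMap B τ z⟫_ℂ).re = 0 := by rw [hB0]; simp
    rw [inner_krausMap, Complex.re_sum, Finset.sum_eq_zero_iff_of_nonneg fun i _ =>
      inner_self_re_nonneg_of_isPositive hτ _] at h1
    have h2 := hker _ (apply_eq_zero_of_isPositive hτ (h1 i (Finset.mem_univ i)))
    rw [← inner_conj_symm, h2 a a.2, map_zero]
  apply Subtype.ext
  have h3 : (W.orthogonalProjectionOnto (a : H) : H) = W.starProjection a := rfl
  have h4 : (W.orthogonalProjectionOnto (restrictKraus L V i a : H) : H) =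
      W.starProjection (restrictKraus L V i a) := rfl
  rw [coe_restrictKraus_apply hW.invariant, h3, h4, coe_restrictKraus_apply hV.invariant]
  have h5 : W.starProjection (L i a - L i (W.starProjection a)) = 0 := by
    rw [← map_sub]
    exact hBV
  rw [map_sub, sub_eq_zero] at h5
  rw [h5, Submodule.starProjection_eq_self_iff]
  exact hW.invariant i _ (W.starProjection_apply_mem _)

lemma inner_orthogonalProjectionOnto_comm (a : V) (b : W) :
    ⟪a, V.orthogonalProjectionOnto (b : H)⟫_ℂ = ⟪W.orthogonalProjectionOnto (a : H), b⟫_ℂ := by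
  rw [Submodule.inner_orthogonalProjectionOnto_eq_of_mem_left,
    Submodule.inner_orthogonalProjectionOnto_eq_of_mem_right]

/-- Minimal enclosures that are not orthogonal carry unitarily equivalent channels. -/
lemma restrictEquiv_of_not_isOrtho (hL : ∑ i, adjoint (L i) * L i = 1)
    (hV : IsMinimalEnclosure (krausMap L) V) (hW : IsMinimalEnclosure (krausMap L) W)
    (hVW : ¬ V ⟂ W) : RestrictEquiv L V W := by
  have : Nontrivial V := Submodule.nontrivial_iff_ne_bot.2 hV.2.1
  let T : V →L[ℂ] W := W.orthogonalProjectionOnto ∘L V.subtypeL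
  let S : W →L[ℂ] V := V.orthogonalProjectionOnto ∘L W.subtypeL
  have hT : ∀ i a, T (restrictKraus L V i a) = restrictKraus L W i (T a) := fun i a =>
    projection_intertwines hL hV hW i a
  have hS : ∀ i a, S (restrictKraus L W i a) = restrictKraus L V i (S a) := fun i a =>
    projection_intertwines hL hW hV i a
  have hST : ∀ a b, ⟪a, S (T b)⟫_ℂ = ⟪T a, T b⟫_ℂ := fun a b => by
    exact inner_orthogonalProjectionOnto_comm a (T b)
  -- `S` is the adjoint of `T`, so Schur's lemma makes `T† T` a scalar and `T` a multiple of an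
  -- isometry. The multiple is nonzero because `V` and `W` are not orthogonal.
  obtain ⟨c, hc'⟩ := exists_forall_apply_eq_smul (K := restrictKraus L V) hV.irreducible
    (G := S ∘L T) fun i a =>
      (congrArg S (hT i a)).trans (hS i (T a))
  replace hc' : ∀ a, S (T a) = c • a := hc'
  obtain ⟨a₀, ha₀⟩ : ∃ a, T a ≠ 0 := by
    by_contra! h
    refine hVW fun a ha => ?_
    exact Submodule.orthogonalProjectionOnto_eq_zero_iff.1 (h ⟨a, ha⟩)
  have hnorm : ∀ a, ((‖T a‖ : ℂ)) ^ 2 = c * (‖a‖ : ℂ) ^ 2 := fun a => by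
    have h1 := hST a a
    rw [hc', inner_smul_right] at h1
    rw [inner_self_eq_norm_sq_to_K, inner_self_eq_norm_sq_to_K] at h1
    exact h1.symm
  have ha₀0 : a₀ ≠ 0 := by rintro rfl; simp at ha₀
  have hn0 : ‖a₀‖ ≠ 0 := norm_ne_zero_iff.2 ha₀0
  set ρ : ℝ := ‖T a₀‖ / ‖a₀‖ with hρ
  have hρ0 : 0 < ρ := div_pos (norm_pos_iff.2 ha₀) (norm_pos_iff.2 ha₀0)
  have hcρ : c = (ρ : ℂ) ^ 2 := by
    have h1 := hnorm a₀
    have h2 : (‖a₀‖ : ℂ) ≠ 0 := by exact_mod_cast hn0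
    rw [hρ, Complex.ofReal_div, div_pow, eq_div_iff (pow_ne_zero 2 h2)]
    exact h1.symm
  have hiso : ∀ a, ‖T a‖ = ρ * ‖a‖ := fun a => by
    have h1 := hnorm a
    rw [hcρ, ← mul_pow] at h1
    have h2 : ‖T a‖ ^ 2 = (ρ * ‖a‖) ^ 2 := by exact_mod_cast h1
    exact (sq_eq_sq₀ (norm_nonneg _) (by positivity)).1 h2
  let U₀ : V →ₗᵢ[ℂ] W :=
    { toLinearMap := (((ρ⁻¹ : ℝ) : ℂ) • T : V →L[ℂ] W)
      norm_map' := fun a => by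
        have : ‖(((ρ⁻¹ : ℝ) : ℂ) • T : V →L[ℂ] W) a‖ = ‖a‖ := by
          rw [smul_apply, norm_smul, hiso, Complex.norm_real, Real.norm_of_nonneg (by positivity),
            inv_mul_cancel_left₀ hρ0.ne']
        exact this }
  have hU₀ : ∀ a, U₀ a = ((ρ⁻¹ : ℝ) : ℂ) • T a := fun a => rfl
  have hinter : ∀ i a, U₀ (restrictKraus L V i a) = restrictKraus L W i (U₀ a) := fun i a => by
    rw [hU₀, hU₀, hT, map_smul]
  -- The range is a nonzero invariant subspace of the irreducible `W`.
  have hsurj : Function.Surjective U₀ := by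
    refine LinearMap.range_eq_top.1 ((hW.irreducible (LinearMap.range U₀.toLinearMap) ?_).resolve_left
      fun h => ?_)
    · rintro i _ ⟨a, rfl⟩
      exact ⟨_, hinter i a⟩
    · have h1 : U₀ a₀ ∈ LinearMap.range U₀.toLinearMap := ⟨a₀, rfl⟩
      rw [h, Submodule.mem_bot, ← norm_eq_zero, U₀.norm_map] at h1
      exact hn0 h1
  exact ⟨LinearIsometryEquiv.ofSurjective U₀ hsurj, hinter⟩

/-- All minimal enclosures in a block carry unitarily equivalent channels. -/
lemma restrictEquiv_of_le_block (hL : ∑ i, adjoint (L i) * L i = 1) {X : Submodule ℂ H}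
    (hX : IsBlock (krausMap L) X) (hV : IsMinimalEnclosure (krausMap L) V) (hVX : V ≤ X)
    (hW : IsMinimalEnclosure (krausMap L) W) (hWX : W ≤ X) : RestrictEquiv L V W := by
  let S : Set (Submodule ℂ H) :=
    {Z | IsMinimalEnclosure (krausMap L) Z ∧ Z ≤ X ∧ RestrictEquiv L V Z}
  have hVS : V ∈ S := ⟨hV, hVX, RestrictEquiv.refl L V⟩
  -- A minimal enclosure not orthogonal to some member of `S` is equivalent to it, and cannot be
  -- orthogonal to `X`, so it lies in `S`. Thus `sSup S` separates, and minimality of the block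
  -- gives `sSup S = X`.
  have hdich : ∀ Z, IsMinimalEnclosure (krausMap L) Z → Z ⟂ sSup S ∨ Z ∈ S := by
    intro Z hZ
    by_cases h : ∃ Y ∈ S, ¬ Y ⟂ Z
    · obtain ⟨Y, hY, hYZ⟩ := h
      refine Or.inr ⟨hZ, ?_, hY.2.2.trans (restrictEquiv_of_not_isOrtho hL hY.1 hZ hYZ)⟩
      exact (hX.1.2.2 Z hZ).resolve_left fun hZX => hYZ (hZX.symm.mono_left hY.2.1)
    · push Not at h
      exact Or.inl (Submodule.IsOrtho.symm (sSup_le h))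
  have hsup : sSup S = X := by
    refine hX.2 _ (isEnclosure_iff.2 fun i => ?_) ?_ ?_ (sSup_le fun Z hZ => hZ.2.1)
    · have : sSup S ≤ (sSup S).comap (L i : H →ₗ[ℂ] H) := sSup_le fun Z hZ y hy =>
        (le_sSup hZ : Z ≤ sSup S) (hZ.1.invariant i y hy)
      exact fun x hx => this hx
    · exact fun h => hV.2.1 (le_bot_iff.1 (h ▸ le_sSup hVS))
    · exact fun Z hZ => (hdich Z hZ).imp_right fun h => le_sSup h
  refine ((hdich W hW).resolve_left fun h => hW.2.1 ?_).2.2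
  rw [hsup] at h
  exact Submodule.isOrtho_self.1 (h.mono_right hWX)

end Equivalence

end OQW

end

/-! ### Assembly of the mean and the covariance -/

theorem lemma4p1 {H : Type*} [NormedAddCommGroup H] [InnerProductSpace ℂ H] [CompleteSpace H]
    [FiniteDimensional ℂ H] {d v : ℕ} (s : Fin v → EuclideanSpace ℝ (Fin d))
    (L : Fin v → H →L[ℂ] H) (hL : ∑ i, ContinuousLinearMap.adjoint (L i) * L i = 1)
    (X : Submodule ℂ H) (hX : OQW.IsBlock (OQW.krausMap L) X) :
    (∃ V, OQW.IsMinimalEnclosure (OQW.krausMap L) V ∧ V ≤ X) ∧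
    (∃! m : EuclideanSpace ℝ (Fin d),
      ∀ V, OQW.IsMinimalEnclosure (OQW.krausMap L) V → V ≤ X → OQW.IsMean s L V m) ∧
    (∃! D : Matrix (Fin d) (Fin d) ℝ,
      ∀ V, OQW.IsMinimalEnclosure (OQW.krausMap L) V → V ≤ X →
        OQW.IsCovariance (OQW.tildeRadius s L V) D ∧
        OQW.IsCovariance (OQW.restrictRadius s L V) D) := by
  obtain ⟨V, hV, hVX⟩ := OQW.exists_isMinimalEnclosure_le hX.1.1 hX.1.2.1
  refine ⟨⟨V, hV, hVX⟩, ?_, ?_⟩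
  · obtain ⟨τ, hτ, hτ1, hτf⟩ := hV.exists_invariant_state hL
    have hmV := OQW.isMean_of_invariant_state s hV hτ hτ1 hτf
    have hτV := OQW.isInvariantStateOn_extend hV hτ hτ1 hτf
    refine ⟨_, fun W hW hWX => ?_, fun m hm =>
      ((hm V hV hVX).2 _ hτV).trans (hmV.2 _ hτV).symm⟩
    · obtain ⟨U, hU⟩ := OQW.restrictEquiv_of_le_block hL hX hV hVX hW hWX
      have hK := OQW.restrictKraus_eq_unitaryConj hU
      -- The invariant state of `V`, transported by `U`, is that of `W`, and conjugation leaves each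
      -- trace in the mean unchanged.
      have hmW := OQW.isMean_of_invariant_state s hW (OQW.isPositive_unitaryConj U hτ)
        (by rw [OQW.tr_unitaryConj, hτ1]) (by rw [OQW.krausMap_unitaryConj U hK, hτf])
      simpa only [hK, OQW.adjoint_unitaryConj, ← OQW.unitaryConj_mul, OQW.tr_unitaryConj]
        using hmW
  · obtain ⟨r, hr, -, hrV⟩ := OQW.exists_radius_branch s hL hV
    obtain ⟨D, hD⟩ := OQW.exists_isCovariance hr
    refine ⟨D, fun W hW hWX => ?_, fun D' hD' =>
      OQW.isCovariance_unique (hD' V hV hVX).2 (hD.congr hrV)⟩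
    obtain ⟨r', hr', ht, hrW⟩ := OQW.exists_radius_branch s hL hW
    -- The restricted radii of `V` and `W` are equal everywhere, whereas the radius on the support
    -- of the absorption operator is compared only near `0`, and only within the same `W`.
    have hDW : OQW.IsCovariance (OQW.restrictRadius s L W) D := by
      rw [← (OQW.restrictEquiv_of_le_block hL hX hV hVX hW hWX).restrictRadius_eq s]
      exact hD.congr hrV
    exact ⟨hDW.congr (ht.trans hrW.symm), hDW⟩
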